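/- **Setting.** A tree-form decision problem is a finite rooted tree alternating between observation points (sequences) $\sigma\in\Sigma$, the root $\varnothing$ being one, and decision points $j\in\mathcal J$ with nonempty action sets $A_j$. The observation points other than $\varnothing$ are the pairs $ja$, $a\in A_j$; $p_j$ is the parent of $j$, $C_\sigma$ is the set of children of $\sigma$, and $d=|\Sigma|$. Let $\mathcal X\subset\{0,1\}^\Sigma$ be the set of sequence-form pure strategies and $\Phi_{\rm Lin}$ the set of linear maps $\mathcal X\to\operatorname{co}\mathcal X$. At each time $t=1,\dots,T$ the player chooses a distribution $\pi^{(t)}$ on $\mathcal X$ with mean $x^{(t)}$, and then a vector $u^{(t)}\in[0,1]^\Sigma$ with $\langle u^{(t)},x\rangle\in[0,1]$ for $x\in\mathcal X$ is revealed; the $\Phi$-regret is $\max_{\phi\in\Phi}\sum_{t\le T}\mathbb E_{x\sim\pi^{(t)}}\langle u^{(t)},\phi(x)-x\rangle$. In the *untimed communication (UTC) decision problem* a deviator at a decision point $v=(j,\tau)\in\mathcal J\times\Sigma$ (real state $j$, mediator state $\tau$) either plays an action $a\in A_j$ (moving to the observation point $(ja,\tau)$, then to $(j',\tau)$ for an observed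 $j'\in C_{ja}$) or queries some $k\in C_\tau$ (moving to $(j,ka)$, where $a$ is the action at $k$ recommended by the mediator's strategy $x\in\mathcal X$). The process starts at the observation point $(\varnothing,\varnothing)$. Let $n_v=|A_j|+|C_\tau|$. The functions $\mathcal X\to\operatorname{co}\mathcal X$ induced by mixed strategies of the deviator form the set $\Phi_{\rm UTC}$. The UTC polytope is the set of all pairs of nonnegative matrices $A\in\mathbb R^{\Sigma\times\Sigma}$, $B\in\mathbb R^{\mathcal J\times\mathcal J}$ with $A(\varnothing,\varnothing)=1$, $A(\varnothing,\tau)=0$ for $\tau\ne\varnothing$, and for all $(j,\tau)\in\mathcal J\times\Sigma$ $$A(p_j,\tau)+B(j,p_\tau)=\sum_{a\in A_j}A(ja,\tau)+\sum_{k\in C_\tau}B(j,k),\qquad B(j,p_\varnothing):=0 .$$ *Counterfactual regret minimization (CFR)* runs one deterministic external regret minimizer $R_v$ over the simplex of the $n_v$ choices at each UTC decision point $v$. In each iteration the local strategies are multiplied along the decision problem into a pair $(A^{(t)},B^{(t)})$, the player plays a fixed point $x^{(t)}=A^{(t)}x^{(t)}\in\operatorname{co}\mathcal X$, and each $R_v$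 receives the counterfactual utilities of its choices for the linear utility $A\mapsto\langle u^{(t)},Ax^{(t)}\rangle$. **Theorem.** For every tree-form decision problem: 1. The UTC polytope is obtained from a single point by successive scaled extensions (adjoining to $y$ the vectors $h(y)w$, $w$ in a simplex, with $h$ linear and nonnegative), one for each UTC decision point $v=(j,\tau)$, by the simplex of the choices at $v$ and with scaling $h=A(p_j,\tau)+B(j,p_\tau)$. 2. For any local regret minimizers $R_v$, the pairs $(A^{(t)},B^{(t)})$ lie in the UTC polytope, $\phi^{(t)}:x\mapsto A^{(t)}x$ is a UTC deviation and maps $\operatorname{co}\mathcal X$ to itself, and every linear map of $\operatorname{co}\mathcal X$ to itself has a fixed point in $\operatorname{co}\mathcal X$. If $R_v$ has regret at most $\rho_v(T)$ against all utility vectors in $[0,1]^{n_v}$, then for all $T$ the $\Phi_{\rm UTC}$-regret and the $\Phi_{\rm Lin}$-regret of the player are at most $\sum_v\rho_v(T)$. In particular, if $\rho_v(T)\le C\,n_v\sqrt T$ for all $v$, where $C\ge0$, both are at most $2C\,d^2\sqrt T$. Local regret minimizers with $\rho_v(T)=n_v\sqrt T$ exist. 3. Each iteration can be carried out by a fixed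 straight-line program that, besides one computation of a fixed point in $\operatorname{co}\mathcal X$ of $\phi^{(t)}:\operatorname{co}\mathcal X\to\operatorname{co}\mathcal X$ and one call of each local minimizer (next strategy, then observed utility), takes at most $Kd^2$ steps (arithmetic operations, and numbers exchanged with these subroutines), with a universal constant $K$. Hence, if the local minimizers take at most $C\,n_v$ steps per iteration, the cost of an iteration is at most $K+2C$ times the cost of the fixed-point computation, where the latter includes one step for each number of its $d\times d$ input and its output. -/

import Mathlib

open Finset

universe u

/-! ## Tree-form decision problems -/

/-- A finite tree-form decision problem.  `Dec` is the set of decision points and `Act j` the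
(nonempty) set of actions at `j`.  The observation points (sequences) are the root and the pairs
`(j, a)`; `parent j` is the observation point that precedes the decision point `j`.
`wf` says that these data form a tree: going up from any node ends at the root. -/
structure TreeFormDecisionProblem where
  Dec : Type u
  Act : Dec → Type u
  [decFintype : Fintype Dec]
  [decDecidableEq : DecidableEq Dec]
  [actFintype : ∀ j, Fintype (Act j)]
  [actDecidableEq : ∀ j, DecidableEq (Act j)]
  [actNonempty : ∀ j, Nonempty (Act j)]
  parent : Dec → Option (Sigma Act)
  wf : WellFounded (fun i j : Dec => ∃ a : Act i, parent j = some ⟨i, a⟩)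

namespace TreeFormDecisionProblem

attribute [instance] decFintype decDecidableEq actFintype actDecidableEq actNonempty

variable (P : TreeFormDecisionProblem.{u})

/-- Sequences (observation points); `none` is the root. -/
abbrev Seq : Type u := Option (Sigma P.Act)

/-- The root observation point. -/
abbrev root : P.Seq := none

/-- The sequence `ja`. -/
abbrev child (j : P.Dec) (a : P.Act j) : P.Seq := some ⟨j, a⟩

/-- `d`, the number of sequences. -/
def size : ℕ := Fintype.card P.Seq

/-- `C_σ`, the set of decision points that follow the observation point `σ`. -/
abbrev Next (σ : P.Seq) : Type u := {j : P.Dec // P.parent j = σ}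

variable {P} in
/-- `Selected plan σ`: the plan selects every action on the path from the root to `σ`. -/
inductive Selected (plan : ∀ j, P.Act j) : P.Seq → Prop
  | root : Selected plan P.root
  | step (j : P.Dec) : Selected plan (P.parent j) → Selected plan (P.child j (plan j))

open Classical in
/-- The sequence-form vector of a plan. -/
noncomputable def pureVector (plan : ∀ j, P.Act j) : P.Seq → ℝ :=
  fun σ => if Selected plan σ then 1 else 0

/-- The set of sequence-form pure strategies. -/
def X : Set (P.Seq → ℝ) := Set.range P.pureVector

noncomputable instance : Fintype P.X :=
  haveI : Finite P.X := Set.finite_range P.pureVector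
  Fintype.ofFinite _

/-- The set of sequence-form mixed strategies. -/
def coX : Set (P.Seq → ℝ) := convexHull ℝ P.X

/-! ## Deviations and regret -/

/-- Functions defined on the pure strategies. -/
abbrev Deviation : Type u := P.X → P.Seq → ℝ

/-- The linear deviations: the linear maps from `X` to `co X`. -/
def linearDeviations : Set P.Deviation :=
  {φ | (∀ x, φ x ∈ P.coX) ∧
    ∃ L : (P.Seq → ℝ) →ₗ[ℝ] (P.Seq → ℝ), ∀ x : P.X, φ x = L x}

/-- Admissible utility vectors: entries in `[0,1]`, and values in `[0,1]` on the strategies. -/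
def IsUtility (w : P.Seq → ℝ) : Prop :=
  (∀ σ, w σ ∈ Set.Icc (0 : ℝ) 1) ∧ ∀ x ∈ P.X, w ⬝ᵥ x ∈ Set.Icc (0 : ℝ) 1

variable {P} in
/-- The mean of a distribution on pure strategies. -/
noncomputable def mean (π : P.X → ℝ) : P.Seq → ℝ := ∑ x : P.X, π x • (x : P.Seq → ℝ)

variable {P} in
/-- `∑_{t < T} E_{x ∼ π t} ⟨w t, φ x - x⟩`. -/
noncomputable def regretAgainst (π : ℕ → P.X → ℝ) (w : ℕ → P.Seq → ℝ) (T : ℕ)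
    (φ : P.Deviation) : ℝ :=
  ∑ t ∈ range T, ∑ x : P.X, π t x * (w t ⬝ᵥ (φ x - x))

variable {P} in
/-- The `Φ`-regret after `T` steps (the maximum over `φ ∈ Φ`) is at most `r`. -/
def PhiRegretLE (Φ : Set P.Deviation) (π : ℕ → P.X → ℝ) (w : ℕ → P.Seq → ℝ) (T : ℕ)
    (r : ℝ) : Prop :=
  ∀ φ ∈ Φ, regretAgainst π w T φ ≤ r

/-! ## The untimed communication (UTC) decision problem -/

/-- Decision points `(j, τ)` of the UTC decision problem: `j` is the current decision point of the
real decision problem and the sequence `τ` is the state of the mediator. -/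
abbrev UDec : Type u := P.Dec × P.Seq

/-- The choices at `(j, τ)`: play an action at `j`, or query a decision point that follows `τ`. -/
abbrev Choice (v : P.UDec) : Type u := P.Act v.1 ⊕ P.Next v.2

/-- The nodes of the UTC decision problem. -/
inductive UNode : Type u
  | obs (σ τ : P.Seq) : UNode
  | dec (j : P.Dec) (τ : P.Seq) : UNode
  | query (j k : P.Dec) : UNode

/-- Pure strategies of the deviator. -/
abbrev PureDeviator : Type u := ∀ v : P.UDec, P.Choice v

variable {P} in
/-- The nodes that the deviator `s` can reach (for some observations in the real decision problem)
when the mediator recommends according to the pure strategy `x`. -/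
inductive Reaches (s : P.PureDeviator) (x : P.X) : P.UNode → Prop
  | root : Reaches s x (.obs P.root P.root)
  | observe (j : P.Dec) (τ : P.Seq) :
      Reaches s x (.obs (P.parent j) τ) → Reaches s x (.dec j τ)
  | play (j : P.Dec) (τ : P.Seq) (a : P.Act j) :
      Reaches s x (.dec j τ) → s (j, τ) = .inl a → Reaches s x (.obs (P.child j a) τ)
  | ask (j : P.Dec) (τ : P.Seq) (k : P.Next τ) :
      Reaches s x (.dec j τ) → s (j, τ) = .inr k → Reaches s x (.query j k)
  | reply (j k : P.Dec) (a : P.Act k) :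
      Reaches s x (.query j k) → (x : P.Seq → ℝ) (P.child k a) = 1 →
        Reaches s x (.dec j (P.child k a))

open Classical in
variable {P} in
/-- The function induced by a pure strategy of the deviator. -/
noncomputable def pureDeviation (s : P.PureDeviator) : P.Deviation :=
  fun x σ => if ∃ τ, Reaches s x (.obs σ τ) then 1 else 0

/-- The UTC deviations: the functions induced by mixed strategies of the deviator. -/
def utcDeviations : Set P.Deviation :=
  {φ | ∃ μ ∈ stdSimplex ℝ P.PureDeviator, φ = ∑ s, μ s • pureDeviation s}

/-! ## The UTC polytope -/

/-- Coordinates of a pair of matrices `(A, B)`, `A` indexed by `Seq × Seq` and `B` by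
`Dec × Dec`. -/
abbrev Coord : Type u := (P.Seq × P.Seq) ⊕ (P.Dec × P.Dec)

variable {P} in
/-- The matrix `A` of a pair `(A, B)`. -/
def devMatrix (z : P.Coord → ℝ) : Matrix P.Seq P.Seq ℝ :=
  Matrix.of fun σ τ => z (.inl (σ, τ))

variable {P} in
/-- `B(j, p_τ)`, which is `0` if `τ` is the root. -/
def queryMass (z : P.Coord → ℝ) (j : P.Dec) : P.Seq → ℝ
  | none => 0
  | some ⟨k, _⟩ => z (.inr (j, k))

variable {P} in
/-- The mass `A(p_j, τ) + B(j, p_τ)` that arrives at the UTC decision point `(j, τ)`. -/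
def arrival (v : P.UDec) (z : P.Coord → ℝ) : ℝ :=
  z (.inl (P.parent v.1, v.2)) + queryMass z v.1 v.2

variable {P} in
/-- The coordinate of a choice at `(j, τ)`: `A(ja, τ)` for an action `a`, `B(j, k)` for a
query `k`. -/
def choiceCoord (v : P.UDec) : P.Choice v → P.Coord
  | .inl a => .inl (P.child v.1 a, v.2)
  | .inr k => .inr (v.1, k)

/-- The polytope of all mixed sequence-form UTC deviations `(A, B)`. -/
def utcPolytope : Set (P.Coord → ℝ) :=
  {z | (∀ v : P.UDec, arrival v z = ∑ i, z (choiceCoord v i)) ∧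
    z (.inl (P.root, P.root)) = 1 ∧
    (∀ τ, τ ≠ P.root → z (.inl (P.root, τ)) = 0) ∧
    ∀ e, 0 ≤ z e}

/-- The starting point of the chain of scaled extensions: `A(root, root) = 1`. -/
def rootPoint : P.Coord → ℝ := Pi.single (.inl (P.root, P.root)) 1

/-- The coordinates `A(root, ·)`. -/
def rootCoords : Finset P.Coord := univ.image fun τ : P.Seq => .inl (P.root, τ)

end TreeFormDecisionProblem

/-! ## Scaled extensions -/

/-- The scaled extension of `S` by the simplex on the new coordinates `G`, with scaling `h`: all
`(y, h(y) • w)` with `y ∈ S` and `w` in the simplex.  Points of `S` vanish on `G`, and `w` vanishes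
off `G`, so that pairs are written as sums. -/
def scaledExtension {E : Type u} (S : Set (E → ℝ)) (h : (E → ℝ) → ℝ) (G : Finset E) :
    Set (E → ℝ) :=
  {z | ∃ y ∈ S, ∃ w : E → ℝ, (∀ e, 0 ≤ w e) ∧ (∀ e ∉ G, w e = 0) ∧ ∑ e ∈ G, w e = 1 ∧
    z = y + h y • w}

/-- `ScaledExtensionChain c F₀ l F S`: starting from the single point `c`, which lives on the
coordinates `F₀`, the successive scaled extensions by the simplices and scaling functions listed
in `l` (each on fresh coordinates, with a linear scaling function that is nonnegative on the set
built so far) give the set `S`, which lives on the coordinates `F`. -/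
inductive ScaledExtensionChain {E : Type u} [DecidableEq E] (c : E → ℝ) (F₀ : Finset E) :
    List (Finset E × ((E → ℝ) → ℝ)) → Finset E → Set (E → ℝ) → Prop
  | point (hc : ∀ e ∉ F₀, c e = 0) : ScaledExtensionChain c F₀ [] F₀ {c}
  | extend (l : List (Finset E × ((E → ℝ) → ℝ))) (F : Finset E) (S : Set (E → ℝ))
      (G : Finset E) (h : (E → ℝ) → ℝ) :
      ScaledExtensionChain c F₀ l F S → G.Nonempty → Disjoint F G → IsLinearMap ℝ h →
      (∀ y ∈ S, 0 ≤ h y) →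
      ScaledExtensionChain c F₀ (l ++ [(G, h)]) (F ∪ G) (scaledExtension S h G)

/-! ## Local regret minimizers and counterfactual regret minimization -/

/-- The utilities of the steps `0, …, t - 1`. -/
def history {ι : Type u} (g : ℕ → ι → ℝ) (t : ℕ) : List (ι → ℝ) := (List.range t).map g

/-- A deterministic online learner on the simplex over `ι`: it maps the list of the utility vectors
observed so far to the next strategy. -/
structure LocalMinimizer (ι : Type u) [Fintype ι] where
  next : List (ι → ℝ) → ι → ℝ
  next_mem : ∀ l, next l ∈ stdSimplex ℝ ι

/-- After `T` steps, the external regret of `R` is at most `ρ T`, for all utility vectors with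
entries in `[0,1]`. -/
def LocalMinimizer.HasRegret {ι : Type u} [Fintype ι] (R : LocalMinimizer ι) (ρ : ℕ → ℝ) : Prop :=
  ∀ (g : ℕ → ι → ℝ), (∀ t i, g t i ∈ Set.Icc (0 : ℝ) 1) → ∀ (T : ℕ), ∀ y ∈ stdSimplex ℝ ι,
    ∑ t ∈ range T, g t ⬝ᵥ (y - R.next (history g t)) ≤ ρ T

namespace TreeFormDecisionProblem

/-- A run of counterfactual regret minimization on the UTC decision problem, with the local
minimizer `R v` at the decision point `v`, that plays fixed points of its iterates against the
utilities `w`.  In step `t`, `strat t v` is the local strategy at `v`, `dev t` the resulting pair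
`(A, B)`, `x t` the mixed strategy that is played, `value t v` the counterfactual value of `v` and
`gain t v i` the counterfactual utility of the choice `i` at `v`, for the linear utility
`A ↦ ⟨w t, A (x t)⟩`. -/
structure CFRRun (P : TreeFormDecisionProblem.{u}) (R : ∀ v : P.UDec, LocalMinimizer (P.Choice v))
    (w : ℕ → P.Seq → ℝ) where
  strat : ℕ → ∀ v : P.UDec, P.Choice v → ℝ
  dev : ℕ → P.Coord → ℝ
  x : ℕ → P.Seq → ℝ
  gain : ℕ → ∀ v : P.UDec, P.Choice v → ℝ
  value : ℕ → P.UDec → ℝ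
  strat_eq : ∀ t v, strat t v = (R v).next (history (fun s => gain s v) t)
  dev_root : ∀ t, dev t (.inl (P.root, P.root)) = 1
  dev_root_of_ne : ∀ t τ, τ ≠ P.root → dev t (.inl (P.root, τ)) = 0
  dev_choice : ∀ t v i, dev t (choiceCoord v i) = strat t v i * arrival v (dev t)
  x_mem : ∀ t, x t ∈ P.coX
  x_fixed : ∀ t, (devMatrix (dev t)).mulVec (x t) = x t
  gain_play : ∀ t (j : P.Dec) (τ : P.Seq) (a : P.Act j),
    gain t (j, τ) (.inl a) =
      w t (P.child j a) * x t τ + ∑ k : P.Next (P.child j a), value t (k.1, τ)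
  gain_query : ∀ t (j : P.Dec) (τ : P.Seq) (k : P.Next τ),
    gain t (j, τ) (.inr k) = ∑ a : P.Act k.1, value t (j, P.child k.1 a)
  value_eq : ∀ t v, value t v = ∑ i, strat t v i * gain t v i

/-! ## Machine model: straight-line programs with oracle calls -/

variable (P : TreeFormDecisionProblem.{u})

/-- Registers: ports for the input `w t`, for the output `x t` of the fixed-point oracle, for its
input matrix, for the strategy and the utility vector exchanged with the local minimizers, and
work registers. -/
inductive Register : Type u
  | utility (σ : P.Seq) : Register
  | play (σ : P.Seq) : Register
  | matrix (σ τ : P.Seq) : Register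
  | strat (v : P.UDec) (i : P.Choice v) : Register
  | gain (v : P.UDec) (i : P.Choice v) : Register
  | work (n : ℕ) : Register

/-- Instructions: arithmetic on single registers, and oracle calls.  `ask v` loads the next
strategy of the local minimizer at `v`, `tell v` hands it a utility vector, and `fix` calls the
fixed-point oracle. -/
inductive Instr : Type u
  | const (dst : P.Register) (n : ℕ) : Instr
  | add (dst a b : P.Register) : Instr
  | mul (dst a b : P.Register) : Instr
  | ask (v : P.UDec) : Instr
  | tell (v : P.UDec) : Instr
  | fix : Instr

/-- Contents of the registers, and the utility vectors that the local minimizers have received. -/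
structure MachineState where
  mem : P.Register → ℝ
  hist : ∀ v : P.UDec, List (P.Choice v → ℝ)

variable {P}

/-- Store a real number in a register. -/
noncomputable def MachineState.store (s : P.MachineState) (r : P.Register) (c : ℝ) :
    P.MachineState :=
  letI := Classical.decEq P.Register
  { s with mem := Function.update s.mem r c }

/-- The effect of one instruction. -/
noncomputable def Instr.exec (R : ∀ v : P.UDec, LocalMinimizer (P.Choice v))
    (fixpt : Matrix P.Seq P.Seq ℝ → P.Seq → ℝ) (s : P.MachineState) :
    P.Instr → P.MachineState
  | .const dst n => s.store dst n
  | .add dst a b => s.store dst (s.mem a + s.mem b)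
  | .mul dst a b => s.store dst (s.mem a * s.mem b)
  | .ask v =>
      { s with mem := fun
          | .strat v' i => if v' = v then (R v').next (s.hist v') i else s.mem (.strat v' i)
          | r => s.mem r }
  | .tell v =>
      { s with hist := fun v' =>
          if v' = v then s.hist v' ++ [fun i => s.mem (.gain v' i)] else s.hist v' }
  | .fix =>
      { s with mem := fun
          | .play σ => fixpt (Matrix.of fun σ' τ' => s.mem (.matrix σ' τ')) σ
          | r => s.mem r }

/-- The number of steps of an instruction.  An arithmetic operation is one step; an oracle call
costs one step for each real number that is handed over, plus the running time of the oracle: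
`f` for the fixed-point oracle, `ca v` and `ct v` for the local minimizer at `v`. -/
def Instr.cost (f : ℕ) (ca ct : P.UDec → ℕ) : P.Instr → ℕ
  | .const _ _ => 1
  | .add _ _ _ => 1
  | .mul _ _ _ => 1
  | .ask v => Fintype.card (P.Choice v) + ca v
  | .tell v => Fintype.card (P.Choice v) + ct v
  | .fix => P.size ^ 2 + P.size + f

/-- The number of steps of a program. -/
def progCost (f : ℕ) (ca ct : P.UDec → ℕ) (p : List P.Instr) : ℕ :=
  (p.map (Instr.cost f ca ct)).sum

/-- Run a program. -/
noncomputable def runProg (R : ∀ v : P.UDec, LocalMinimizer (P.Choice v))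
    (fixpt : Matrix P.Seq P.Seq ℝ → P.Seq → ℝ) (p : List P.Instr) (s : P.MachineState) :
    P.MachineState :=
  p.foldl (Instr.exec R fixpt) s

/-- The environment writes a utility vector into the input port. -/
def MachineState.observe (s : P.MachineState) (w : P.Seq → ℝ) : P.MachineState :=
  { s with mem := fun
      | .utility σ => w σ
      | r => s.mem r }

/-- The state at the beginning of iteration `t`.  An iteration runs `p` (which produces the play),
then the utility vector is revealed, then `q` runs. -/
noncomputable def stateAt (R : ∀ v : P.UDec, LocalMinimizer (P.Choice v))
    (fixpt : Matrix P.Seq P.Seq ℝ → P.Seq → ℝ) (p q : List P.Instr) (w : ℕ → P.Seq → ℝ) :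
    ℕ → P.MachineState
  | 0 => { mem := fun _ => 0, hist := fun _ => [] }
  | t + 1 => runProg R fixpt q ((runProg R fixpt p (stateAt R fixpt p q w t)).observe (w t))

/-- The state in iteration `t` when the play has been produced, before the utility is revealed. -/
noncomputable def playState (R : ∀ v : P.UDec, LocalMinimizer (P.Choice v))
    (fixpt : Matrix P.Seq P.Seq ℝ → P.Seq → ℝ) (p q : List P.Instr) (w : ℕ → P.Seq → ℝ) (t : ℕ) :
    P.MachineState :=
  runProg R fixpt p (stateAt R fixpt p q w t)

/-- `fixpt` returns a fixed point in `co X` for every matrix that maps `co X` to `co X`. -/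
def IsFixedPointOracle (fixpt : Matrix P.Seq P.Seq ℝ → P.Seq → ℝ) : Prop :=
  ∀ M : Matrix P.Seq P.Seq ℝ, Set.MapsTo M.mulVec P.coX P.coX →
    fixpt M ∈ P.coX ∧ M.mulVec (fixpt M) = fixpt M

end TreeFormDecisionProblem

/-! The polytope is large enough to contain every linear deviation, yet its constraints are the flow
constraints of a decision tree, so that CFR applies to it.

Representation. On strategies, a weight vector on sequences matters only modulo `gauge`: moving a
number from all children of a decision point to its parent sequence changes no value, by
conservation of mass. Backward induction picks one representative in each class, the normal one,
which is nonnegative below the root with a zero among the children of every decision point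
(`exists_isNormal_gauge`, `IsNormal.eq`). Its root entry is the minimum over pure strategies, so a
functional that is nonnegative on `X` has a nonnegative normal form. For a linear map into `co X`,
the normal forms of the rows are the matrix `A`; row `p_j` and the sum of the rows `ja` agree on
`X`, hence differ by a gauge, and its coefficients are `B(j, ·)`. This is
`exists_mem_utcPolytope_of_linear`. Mixtures of pure deviators are in the polytope because each pure
deviator acts by the 0/1 matrix it generates (`Generates.pureDeviation_eq`).

Regret. Counterfactual values telescope along the tree: for every point `z` of the polytope, the
local advantages weighted by `z` add up to the utility of `z` minus a constant that does not depend
on `z` (`CFRRun.sum_advantage`). The iterate itself has total advantage zero and fixes `x`, so the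
gain of `z` over the play is exactly a sum of local regrets, each scaled by the mass that `z` brings
to `v`. That mass is at most one, although each `(j, τ)` can be entered in two ways: the masses
entering along the path to `τ` are part of `(A x)(p_j)` for a pure strategy `x` through `τ`
(`arrival_le_one`). Gains stay in `[0,1]` since they are bounded by `x(τ)` times the best future
utility at `j` (`CFRRun.gain_mem_Icc`). Local minimizers exist by regret matching.

Validity of the play. The local strategies define a product distribution on pure deviators, and the
mass arriving at `v` depends only on choices at smaller depth, hence is independent of the choice at
`v`. So the iterate is a mixture of pure deviators (`Generates.mem_utcDeviations`), which map `X` to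
`X` because integral flows are pure strategies. Fixed points come from averaging an orbit.

Structure and cost. The depth of `j` plus that of `τ` grades the problem: coordinates feeding `v`
have the depth of `v`, its choices one more. Sorting by depth gives the chain of scaled extensions
and a schedule for both passes. There are at most `2 d ^ 2` choices in total, since each `k` is
queried only from the states `τ = p_k`. -/

namespace TreeFormDecisionProblem

/-! ### Induction and counting along the tree. -/

section Tree

variable (P : TreeFormDecisionProblem.{u})

/-- The number of decision points above `j`. -/
noncomputable def depth : P.Dec → ℕ :=
  P.wf.fix fun j rec =>
    match h : P.parent j with
    | none => 0
    | some ⟨i, a⟩ => rec i ⟨a, h⟩ + 1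

/-- The number of decision points above the sequence `σ`. -/
noncomputable def seqDepth : P.Seq → ℕ
  | none => 0
  | some ⟨j, _⟩ => P.depth j + 1

theorem seqDepth_parent (j : P.Dec) : P.seqDepth (P.parent j) = P.depth j := by
  rw [depth, WellFounded.fix_eq]
  split
  · next h => rw [h]; rfl
  · next i a h => exact (congrArg P.seqDepth h).trans rfl

variable {P}

@[simp] theorem seqDepth_child (j : P.Dec) (a : P.Act j) :
    P.seqDepth (P.child j a) = P.depth j + 1 := rfl

theorem depth_of_parent {j k : P.Dec} {a : P.Act j} (h : P.parent k = P.child j a) :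
    P.depth k = P.depth j + 1 := by
  rw [← P.seqDepth_parent, h, seqDepth_child]

/-- Induction along the tree, from the root downwards. -/
theorem seq_induction {p : P.Seq → Prop} (root : p P.root)
    (step : ∀ j, p (P.parent j) → ∀ a, p (P.child j a)) (σ : P.Seq) : p σ := by
  induction h : P.seqDepth σ using Nat.strong_induction_on generalizing σ with
  | _ n ih =>
    rcases σ with _ | ⟨j, a⟩
    · exact root
    · refine step j (ih (P.seqDepth (P.parent j)) ?_ _ rfl) a
      rw [← h, seqDepth_parent]
      exact Nat.lt_succ_self _

/-- Induction along the tree, from the leaves upwards. -/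
theorem dec_induction {p : P.Dec → Prop}
    (step : ∀ j, (∀ a, ∀ k : P.Next (P.child j a), p k.1) → p j) (j : P.Dec) : p j := by
  obtain ⟨N, hN⟩ : ∃ N, ∀ k, P.depth k ≤ N :=
    ⟨univ.sup P.depth, fun k => le_sup (f := P.depth) (mem_univ k)⟩
  induction h : N - P.depth j using Nat.strong_induction_on generalizing j with
  | _ n ih =>
    refine step j fun a k => ih _ ?_ k.1 rfl
    have h1 := depth_of_parent k.2
    have h2 := hN k.1
    omega

theorem sum_seq {M : Type*} [AddCommMonoid M] (f : P.Seq → M) :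
    ∑ σ, f σ = f P.root + ∑ j, ∑ a, f (P.child j a) := by
  rw [Fintype.sum_option, Fintype.sum_sigma]

theorem sum_next {M : Type*} [AddCommMonoid M] (f : P.Seq → P.Dec → M) :
    ∑ σ, ∑ k : P.Next σ, f σ k.1 = ∑ k, f (P.parent k) k := by
  rw [← Fintype.sum_sigma' (fun σ (k : P.Next σ) => f σ k.1)]
  rw [← (Equiv.sigmaFiberEquiv P.parent).sum_comp]
  refine Fintype.sum_congr _ _ ?_
  rintro ⟨σ, k, rfl⟩
  rfl

theorem card_dec_lt_size : Fintype.card P.Dec < P.size := by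
  have : Fintype.card P.Dec ≤ Fintype.card (Sigma P.Act) :=
    Fintype.card_le_of_injective (fun j => ⟨j, Classical.arbitrary _⟩) fun i j h =>
      congrArg Sigma.fst h
  rw [size, Fintype.card_option]
  omega

theorem sum_card_act : ∑ j, Fintype.card (P.Act j) + 1 = P.size := by
  rw [size, Fintype.card_option, Fintype.card_sigma]

theorem sum_card_next : ∑ σ, Fintype.card (P.Next σ) = Fintype.card P.Dec := by
  have := sum_next (P := P) (fun _ _ => 1)
  simpa only [sum_const, card_univ, smul_eq_mul, mul_one] using this

/-- Actions are counted once for each mediator state, which gives `d * (d - 1)`. A query of `k` is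
possible at a single state only, so queries contribute just the square of the number of decision
points. -/
theorem sum_card_choice_le : ∑ v : P.UDec, Fintype.card (P.Choice v) ≤ 2 * P.size ^ 2 := by
  have h1 := card_dec_lt_size (P := P)
  have h2 := sum_card_act (P := P)
  have h3 : ∑ v : P.UDec, Fintype.card (P.Choice v) =
      P.size * (∑ j, Fintype.card (P.Act j)) + Fintype.card P.Dec * Fintype.card P.Dec := by
    simp only [Fintype.card_sum, Fintype.sum_prod_type, sum_add_distrib, sum_card_next, sum_const,
      card_univ, smul_eq_mul, mul_sum]
    congr 1
    exact Fintype.sum_congr _ _ fun j => (sum_const (Fintype.card (P.Act j))).trans rfl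
  rw [h3]
  nlinarith

end Tree

/-! ### The sequence form -/

section SequenceForm

variable {P : TreeFormDecisionProblem.{u}}

/-- The linear constraints of sequence-form strategies. -/
structure IsFlow (x : P.Seq → ℝ) : Prop where
  root : x P.root = 1
  nonneg : ∀ σ, 0 ≤ x σ
  sum_child : ∀ k, ∑ a, x (P.child k a) = x (P.parent k)

theorem selected_child {plan : ∀ j, P.Act j} {j : P.Dec} {a : P.Act j} :
    Selected plan (P.child j a) ↔ plan j = a ∧ Selected plan (P.parent j) := by
  constructor
  · intro h
    cases h with
    | step _ h => exact ⟨rfl, h⟩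
  · rintro ⟨rfl, h⟩
    exact .step j h

theorem pureVector_root (plan : ∀ j, P.Act j) : P.pureVector plan P.root = 1 :=
  if_pos .root

theorem pureVector_child (plan : ∀ j, P.Act j) (j : P.Dec) (a : P.Act j) :
    P.pureVector plan (P.child j a) = if plan j = a then P.pureVector plan (P.parent j) else 0 := by
  unfold pureVector
  by_cases h : plan j = a <;> by_cases h' : Selected plan (P.parent j) <;>
    simp [selected_child, h, h']

theorem pureVector_zero_or_one (plan : ∀ j, P.Act j) (σ : P.Seq) :
    P.pureVector plan σ = 0 ∨ P.pureVector plan σ = 1 := by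
  unfold pureVector
  split_ifs <;> simp

theorem isFlow_pureVector (plan : ∀ j, P.Act j) : IsFlow (P.pureVector plan) where
  root := pureVector_root plan
  nonneg σ := by rcases pureVector_zero_or_one plan σ with h | h <;> simp [h]
  sum_child k := by simp [pureVector_child]

theorem convex_setOf_isFlow : Convex ℝ {x : P.Seq → ℝ | IsFlow x} := by
  intro x hx y hy a b ha hb hab
  refine ⟨?_, fun σ => ?_, fun k => ?_⟩
  · simp [hx.root, hy.root, hab]
  · have := hx.nonneg σ
    have := hy.nonneg σ
    simp only [Pi.add_apply, Pi.smul_apply, smul_eq_mul]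
    positivity
  · simp only [Pi.add_apply, Pi.smul_apply, smul_eq_mul, sum_add_distrib, ← mul_sum, hx.sum_child,
      hy.sum_child]

theorem isFlow_of_mem_X {x : P.Seq → ℝ} (hx : x ∈ P.X) : IsFlow x := by
  obtain ⟨plan, rfl⟩ := hx
  exact isFlow_pureVector plan

theorem isFlow_of_mem_coX {x : P.Seq → ℝ} (hx : x ∈ P.coX) : IsFlow x :=
  convexHull_min (fun _ h => isFlow_of_mem_X h) convex_setOf_isFlow hx

theorem IsFlow.child_le {x : P.Seq → ℝ} (hx : IsFlow x) (j : P.Dec) (a : P.Act j) :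
    x (P.child j a) ≤ x (P.parent j) := by
  rw [← hx.sum_child]
  exact single_le_sum (f := fun a => x (P.child j a)) (fun _ _ => hx.nonneg _) (mem_univ a)

theorem IsFlow.le_one {x : P.Seq → ℝ} (hx : IsFlow x) (σ : P.Seq) : x σ ≤ 1 := by
  induction σ using seq_induction with
  | root => exact hx.root.le
  | step j ih a => exact (hx.child_le j a).trans ih

/-- Integral flows are pure strategies. -/
theorem IsFlow.mem_X {x : P.Seq → ℝ} (hx : IsFlow x) (h01 : ∀ σ, x σ = 0 ∨ x σ = 1) :
    x ∈ P.X := by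
  classical
  have hex : ∀ j, ∃ a, ∀ b, x (P.child j b) = if a = b then x (P.parent j) else 0 := by
    intro j
    -- Where no mass arrives all actions carry zero and the choice is immaterial; where mass one
    -- arrives, integrality puts it on a single action.
    rcases h01 (P.parent j) with h | h
    · refine ⟨Classical.arbitrary _, fun b => ?_⟩
      have := hx.child_le j b
      have := hx.nonneg (P.child j b)
      split_ifs <;> linarith
    · have hs := hx.sum_child j
      obtain ⟨a, ha⟩ : ∃ a, x (P.child j a) = 1 := by
        by_contra! hne
        rw [sum_eq_zero fun a _ => (h01 _).resolve_right (hne a)] at hs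
        linarith
      refine ⟨a, fun b => ?_⟩
      split_ifs with hab
      · rw [← hab, ha, h]
      · have := add_le_sum (f := fun a => x (P.child j a)) (fun _ _ => hx.nonneg _) (mem_univ a)
          (mem_univ b) hab
        have := hx.nonneg (P.child j b)
        linarith
  choose plan hplan using hex
  refine ⟨plan, funext fun σ => ?_⟩
  induction σ using seq_induction with
  | root => rw [pureVector_root, hx.root]
  | step j ih a => rw [pureVector_child, hplan, ih]

/-- Some plan selects a given sequence. -/
theorem exists_plan_selected (σ : P.Seq) : ∃ plan : ∀ j, P.Act j, Selected plan σ := by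
  classical
  suffices ∃ plan : ∀ j, P.Act j, Selected plan σ ∧
      ∀ j, P.seqDepth σ ≤ P.depth j → plan j = Classical.arbitrary _ from
    this.imp fun _ h => h.1
  induction σ using seq_induction with
  | root => exact ⟨fun _ => Classical.arbitrary _, .root, fun _ _ => rfl⟩
  | step j ih a =>
    obtain ⟨plan, hsel, hplan⟩ := ih
    refine ⟨Function.update plan j a, ?_, fun i hi => ?_⟩
    · rw [selected_child]
      refine ⟨Function.update_self .., ?_⟩
      -- Changing the plan at `j` cannot affect sequences that are no deeper than `j`.
      have hd : ∀ σ, Selected plan σ → P.seqDepth σ ≤ P.depth j →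
          Selected (Function.update plan j a) σ := by
        intro σ h
        induction h with
        | root => exact fun _ => .root
        | step i _ ih =>
          intro hi
          rw [seqDepth_child] at hi
          rw [selected_child]
          refine ⟨Function.update_of_ne (by rintro rfl; omega) .., ih ?_⟩
          rw [seqDepth_parent]
          omega
      exact hd _ hsel (P.seqDepth_parent j).le
    · rw [seqDepth_child] at hi
      rw [Function.update_of_ne (by rintro rfl; omega)]
      exact hplan i (by rw [seqDepth_parent]; omega)

end SequenceForm

/-! ### Shifting weights along the tree -/

section Gauge

variable {P : TreeFormDecisionProblem.{u}}

/-- The value of `b` at the decision point that precedes a sequence, and `0` at the root. -/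
def before (b : P.Dec → ℝ) : P.Seq → ℝ
  | none => 0
  | some ⟨k, _⟩ => b k

/-- The weights on sequences that arise by moving `b k` from all children of `k` to the parent. -/
def gauge (b : P.Dec → ℝ) (σ : P.Seq) : ℝ := ∑ k : P.Next σ, b k.1 - before b σ

@[simp] theorem before_root (b : P.Dec → ℝ) : before b P.root = 0 := rfl

@[simp] theorem before_child (b : P.Dec → ℝ) (k : P.Dec) (a : P.Act k) :
    before b (P.child k a) = b k := rfl

theorem gauge_root (b : P.Dec → ℝ) : gauge b P.root = ∑ k : P.Next P.root, b k.1 := by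
  simp [gauge]

theorem gauge_child (b : P.Dec → ℝ) (k : P.Dec) (a : P.Act k) :
    gauge b (P.child k a) = ∑ i : P.Next (P.child k a), b i.1 - b k := rfl

/-- Both sides are the sum of `b k * x (P.parent k)` over all `k`: the left one by conservation of
mass at `k`, the right one by grouping the `k` by their parents. -/
theorem sum_before_mul {x : P.Seq → ℝ} (hx : IsFlow x) (b : P.Dec → ℝ) :
    ∑ σ, before b σ * x σ = ∑ σ, (∑ k : P.Next σ, b k.1) * x σ := by
  have h2 : ∑ σ, (∑ k : P.Next σ, b k.1) * x σ = ∑ k, b k * x (P.parent k) := by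
    simp only [sum_mul]
    exact sum_next fun σ k => b k * x σ
  rw [h2, sum_seq]
  simp only [before_root, zero_mul, zero_add, before_child, ← mul_sum, hx.sum_child]

theorem gauge_dotProduct {x : P.Seq → ℝ} (hx : IsFlow x) (b : P.Dec → ℝ) :
    gauge b ⬝ᵥ x = 0 := by
  simp only [dotProduct, gauge, sub_mul, sum_sub_distrib, sum_before_mul hx, sub_self]

theorem gauge_neg (b : P.Dec → ℝ) : gauge (-b) = -gauge b := by
  funext σ
  rcases σ with _ | ⟨k, a⟩ <;> simp [gauge, before]; ring

/-- Weights that are nonnegative below the root and vanish at some child of every decision point. -/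
def IsNormal (c : P.Seq → ℝ) : Prop :=
  ∀ k, (∀ a, 0 ≤ c (P.child k a)) ∧ ∃ a, c (P.child k a) = 0

end Gauge

end TreeFormDecisionProblem

/-- Well-founded recursion for an operator on functions. -/
theorem WellFounded.exists_fixed_fun {ι α : Type*} [Nonempty α] {r : ι → ι → Prop}
    (hr : WellFounded r) (F : (ι → α) → ι → α)
    (hF : ∀ f g i, (∀ j, r j i → f j = g j) → F f i = F g i) : ∃ f, ∀ i, f i = F f i := by
  classical
  refine ⟨hr.fix fun i rec => F (fun j => if h : r j i then rec j h else Classical.arbitrary α) i,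
    fun i => ?_⟩
  rw [WellFounded.fix_eq]
  refine hF _ _ i fun j hj => ?_
  rw [dif_pos hj]

namespace TreeFormDecisionProblem

/-! ### Normal forms of linear functionals on strategies. -/

section Gauge

variable {P : TreeFormDecisionProblem.{u}}

theorem exists_isNormal_gauge (c : P.Seq → ℝ) : ∃ b, IsNormal (c + gauge b) := by
  have hwf : WellFounded fun i j : P.Dec => P.depth j < P.depth i := by
    obtain ⟨N, hN⟩ : ∃ N, ∀ k, P.depth k ≤ N :=
      ⟨univ.sup P.depth, fun k => le_sup (f := P.depth) (mem_univ k)⟩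
    refine Subrelation.wf ?_ (measure fun j => N - P.depth j).wf
    intro i j h
    have := hN i
    have := hN j
    change N - _ < N - _
    omega
  -- Bellman recursion: `b k` is the least cost to go from `k`. The shifted weight of an action is
  -- then its excess over the optimum, which is nonnegative and zero at a minimizer.
  obtain ⟨b, hb⟩ := hwf.exists_fixed_fun
    (fun b k => univ.inf' univ_nonempty fun a => c (P.child k a) +
      ∑ i : P.Next (P.child k a), b i.1) (by
    intro f g k h
    refine inf'_congr _ rfl fun a _ => ?_
    congr 1
    refine Fintype.sum_congr _ _ fun i => h _ ?_
    rw [depth_of_parent i.2]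
    exact Nat.lt_succ_self _)
  refine ⟨b, fun k => ⟨fun a => ?_, ?_⟩⟩
  · have : b k ≤ c (P.child k a) + ∑ i : P.Next (P.child k a), b i.1 := by
      rw [hb k]
      exact inf'_le _ (mem_univ a)
    simp only [Pi.add_apply, gauge_child]
    linarith
  · obtain ⟨a, -, ha⟩ := exists_mem_eq_inf' (univ_nonempty (α := P.Act k)) fun a =>
      c (P.child k a) + ∑ i : P.Next (P.child k a), b i.1
    refine ⟨a, ?_⟩
    rw [← hb k] at ha
    simp only [Pi.add_apply, gauge_child]
    linarith

/-- At an action of shifted weight zero, `b j` equals the cost of the action plus the values below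
it, all nonnegative by induction from the leaves. -/
theorem gauge_nonneg_of_isNormal {c : P.Seq → ℝ} (hc : ∀ σ, 0 ≤ c σ) {b : P.Dec → ℝ}
    (hb : IsNormal (c + gauge b)) (k : P.Dec) : 0 ≤ b k := by
  induction k using dec_induction with
  | step j ih =>
    obtain ⟨a, ha⟩ := (hb j).2
    have h1 := sum_nonneg fun k (_ : k ∈ univ) => ih a k
    have h2 := hc (P.child j a)
    simp only [Pi.add_apply, gauge_child] at ha
    linarith

/-- Some pure strategy only uses sequences of weight zero. -/
theorem exists_dotProduct_eq_of_isNormal {c : P.Seq → ℝ} (hc : IsNormal c) :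
    ∃ x ∈ P.X, c ⬝ᵥ x = c P.root := by
  choose plan hplan using fun k => (hc k).2
  refine ⟨_, ⟨plan, rfl⟩, ?_⟩
  rw [dotProduct, sum_seq, pureVector_root, mul_one, add_eq_left]
  refine sum_eq_zero fun j _ => sum_eq_zero fun a _ => ?_
  rw [pureVector_child]
  split_ifs with h
  · rw [← h, hplan, zero_mul]
  · rw [mul_zero]

theorem add_gauge_dotProduct {x : P.Seq → ℝ} (hx : IsFlow x) (c : P.Seq → ℝ) (b : P.Dec → ℝ) :
    (c + gauge b) ⬝ᵥ x = c ⬝ᵥ x := by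
  rw [add_dotProduct, gauge_dotProduct hx, add_zero]

/-- Only the root entry is in question, and it is the value of a pure strategy that follows the
zeros. -/
theorem nonneg_of_isNormal {c : P.Seq → ℝ} (hn : IsNormal c) (hc : ∀ x ∈ P.X, 0 ≤ c ⬝ᵥ x)
    (σ : P.Seq) : 0 ≤ c σ := by
  rcases σ with _ | ⟨j, a⟩
  · obtain ⟨x, hx, h⟩ := exists_dotProduct_eq_of_isNormal hn
    exact h ▸ hc x hx
  · exact (hn j).1 a

/-- Weights that vanish on all strategies are shifts of zero. -/
theorem exists_eq_gauge {c : P.Seq → ℝ} (hc : ∀ x ∈ P.X, c ⬝ᵥ x = 0) : ∃ b, c = gauge b := by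
  obtain ⟨b, hb⟩ := exists_isNormal_gauge c
  have h0 : ∀ x ∈ P.X, (c + gauge b) ⬝ᵥ x = 0 := fun x hx => by
    rw [add_gauge_dotProduct (isFlow_of_mem_X hx), hc x hx]
  have hnn := nonneg_of_isNormal hb fun x hx => (h0 x hx).ge
  have hz : c + gauge b = 0 := by
    funext σ
    obtain ⟨plan, hplan⟩ := exists_plan_selected σ
    have hsum := h0 _ ⟨plan, rfl⟩
    have hp : P.pureVector plan σ = 1 := if_pos hplan
    -- The value on the chosen plan is a vanishing sum of nonnegative terms, one of which is the
    -- weight at `σ`.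
    have := (sum_eq_zero_iff_of_nonneg fun τ _ =>
      mul_nonneg (hnn τ) ((isFlow_pureVector plan).nonneg τ)).1 hsum σ (mem_univ _)
    rwa [hp, mul_one] at this
  exact ⟨-b, by rw [gauge_neg]; exact eq_neg_of_add_eq_zero_left hz⟩

/-- Normal weights are determined by their values on strategies. -/
theorem IsNormal.eq {c c' : P.Seq → ℝ} (hc : IsNormal c) (hc' : IsNormal c')
    (h : ∀ x ∈ P.X, c ⬝ᵥ x = c' ⬝ᵥ x) : c = c' := by
  obtain ⟨b, hb⟩ := exists_eq_gauge (c := c - c') fun x hx => by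
    rw [sub_dotProduct, h x hx, sub_self]
  have hb0 : ∀ k, b k = 0 := by
    intro k
    induction k using dec_induction with
    | step j ih =>
      -- Once `b` vanishes below `j`, the two weights differ by a constant on the actions at `j`.
      -- Both have minimum zero there, so the constant is zero.
      have he : ∀ a, c (P.child j a) - c' (P.child j a) = - b j := by
        intro a
        have := congrFun hb (P.child j a)
        rwa [gauge_child, Fintype.sum_eq_zero _ (ih a), zero_sub] at this
      obtain ⟨a, ha⟩ := (hc j).2
      obtain ⟨a', ha'⟩ := (hc' j).2
      have h1 := he a
      have h2 := he a'
      have h3 := (hc' j).1 a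
      have h4 := (hc j).1 a'
      linarith
  have : gauge b = 0 := by
    funext σ
    rcases σ with _ | ⟨k, a⟩ <;> simp [gauge, before, hb0]
  rw [this] at hb
  exact sub_eq_zero.1 hb

end Gauge

end TreeFormDecisionProblem

namespace TreeFormDecisionProblem

/-! ### Coordinates of the UTC polytope -/

section Coordinates

variable {P : TreeFormDecisionProblem.{u}}

theorem queryMass_eq_before (z : P.Coord → ℝ) (j : P.Dec) (τ : P.Seq) :
    queryMass z j τ = before (fun k => z (.inr (j, k))) τ := by
  rcases τ with _ | ⟨k, a⟩ <;> rfl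

/-- The coordinate `e` contributes to the mass that arrives at `v`. -/
inductive Feeds : P.Coord → P.UDec → Prop
  | observe (j : P.Dec) (τ : P.Seq) : Feeds (.inl (P.parent j, τ)) (j, τ)
  | reply (j k : P.Dec) (a : P.Act k) : Feeds (.inr (j, k)) (j, P.child k a)

theorem arrival_congr {z z' : P.Coord → ℝ} {v : P.UDec} (h : ∀ e, Feeds e v → z e = z' e) :
    arrival v z = arrival v z' := by
  obtain ⟨j, _ | ⟨k, a⟩⟩ := v
  · simp [arrival, queryMass, h _ (.observe j _)]
  · simp [arrival, queryMass, h _ (.observe j _), h _ (.reply j k a)]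

theorem arrival_nonneg {z : P.Coord → ℝ} {v : P.UDec} (h : ∀ e, Feeds e v → 0 ≤ z e) :
    0 ≤ arrival v z := by
  obtain ⟨j, _ | ⟨k, a⟩⟩ := v
  · simpa [arrival, queryMass] using h _ (.observe j _)
  · exact add_nonneg (h _ (.observe j _)) (h _ (.reply j k a))

theorem isLinearMap_arrival (v : P.UDec) : IsLinearMap ℝ (arrival (P := P) v) := by
  obtain ⟨j, _ | ⟨k, a⟩⟩ := v
  · constructor <;> intros <;> simp [arrival, queryMass]
  · constructor <;> intros <;> simp [arrival, queryMass] <;> ring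

variable (P) in
/-- The number of choices made before a decision point of the UTC problem is reached. -/
noncomputable def decDepth (v : P.UDec) : ℕ := P.depth v.1 + P.seqDepth v.2

variable (P) in
/-- The number of choices made before a node that carries a coordinate is reached. -/
noncomputable def coordDepth : P.Coord → ℕ
  | .inl (σ, τ) => P.seqDepth σ + P.seqDepth τ
  | .inr (j, k) => P.depth j + P.depth k + 1

/-- With `coordDepth_choiceCoord` this is the grading that makes the UTC problem acyclic, and every
recursion and ordering below relies on it. -/
theorem Feeds.coordDepth_eq {e : P.Coord} {v : P.UDec} (h : Feeds e v) :
    P.coordDepth e = P.decDepth v := by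
  cases h with
  | observe j τ => simp [coordDepth, decDepth, seqDepth_parent]
  | reply j k a => simp [coordDepth, decDepth, add_assoc]

theorem coordDepth_choiceCoord (v : P.UDec) (i : P.Choice v) :
    P.coordDepth (choiceCoord v i) = P.decDepth v + 1 := by
  obtain ⟨j, τ⟩ := v
  rcases i with a | ⟨k, (rfl : P.parent k = τ)⟩
  · simp only [choiceCoord, coordDepth, decDepth, seqDepth_child]
    omega
  · simp only [choiceCoord, coordDepth, decDepth, seqDepth_parent]

theorem eq_root_or_exists_choiceCoord (e : P.Coord) :
    (∃ τ, e = .inl (P.root, τ)) ∨ ∃ v i, choiceCoord v i = e := by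
  rcases e with ⟨_ | ⟨j, a⟩, τ⟩ | ⟨j, k⟩
  · exact .inl ⟨τ, rfl⟩
  · exact .inr ⟨(j, τ), .inl a, rfl⟩
  · exact .inr ⟨(j, P.parent k), .inr ⟨k, rfl⟩, rfl⟩

theorem choiceCoord_ne_root (v : P.UDec) (i : P.Choice v) (τ : P.Seq) :
    choiceCoord v i ≠ .inl (P.root, τ) := by
  rcases i with a | k <;> simp [choiceCoord]

/-- For a query the mediator state is recovered from the coordinate, since it must be the parent of
`k`. Hence the blocks of coordinates of different decision points are disjoint. -/
theorem choiceCoord_injective :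
    Function.Injective fun p : Σ v : P.UDec, P.Choice v => choiceCoord p.1 p.2 := by
  rintro ⟨⟨j, τ⟩, i⟩ ⟨⟨j', τ'⟩, i'⟩ h
  rcases i with a | ⟨k, (rfl : P.parent k = τ)⟩ <;> rcases i' with a' | ⟨k', (rfl : P.parent k' = τ')⟩ <;>
    simp only [choiceCoord, Sum.inl.injEq, Sum.inr.injEq, Prod.mk.injEq, child, Option.some.injEq,
      reduceCtorEq] at h
  · obtain ⟨h, rfl⟩ := h
    cases h
    rfl
  · obtain ⟨rfl, rfl⟩ := h
    rfl

/-- Induction over the coordinates, from the root downwards. -/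
theorem coord_induction {p : P.Coord → Prop} (root : ∀ τ, p (.inl (P.root, τ)))
    (step : ∀ v, (∀ e, Feeds e v → p e) → ∀ i, p (choiceCoord v i)) (e : P.Coord) : p e := by
  induction h : P.coordDepth e using Nat.strong_induction_on generalizing e with
  | _ n ih =>
    obtain ⟨τ, rfl⟩ | ⟨v, i, rfl⟩ := eq_root_or_exists_choiceCoord e
    · exact root τ
    · refine step v (fun e he => ih _ ?_ e rfl) i
      rw [← h, coordDepth_choiceCoord, he.coordDepth_eq]
      exact Nat.lt_succ_self _

/-- The pair of matrices `z` arises from the local strategies `β` by multiplication along the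
decision problem. -/
structure Generates (β : ∀ v : P.UDec, P.Choice v → ℝ) (z : P.Coord → ℝ) : Prop where
  root : z (.inl (P.root, P.root)) = 1
  root_of_ne : ∀ τ, τ ≠ P.root → z (.inl (P.root, τ)) = 0
  choice : ∀ v i, z (choiceCoord v i) = β v i * arrival v z

theorem exists_generates (β : ∀ v : P.UDec, P.Choice v → ℝ) : ∃ z, Generates β z := by
  obtain ⟨z, hz⟩ := (measure P.coordDepth).wf.exists_fixed_fun
    (fun (z : P.Coord → ℝ) (e : P.Coord) => match e with
      | .inl (none, τ) => if τ = none then (1 : ℝ) else 0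
      | .inl (some ⟨j, a⟩, τ) => β (j, τ) (.inl a) * arrival (j, τ) z
      | .inr (j, k) => β (j, P.parent k) (.inr ⟨k, rfl⟩) * arrival (j, P.parent k) z) (by
    intro f g e h
    have key : ∀ v i, choiceCoord v i = e → arrival v f = arrival v g := fun v i hi =>
      arrival_congr fun e' he' => h e' (by
        change P.coordDepth e' < P.coordDepth e
        rw [← hi, coordDepth_choiceCoord, he'.coordDepth_eq]
        exact Nat.lt_succ_self _)
    rcases e with ⟨_ | ⟨j, a⟩, τ⟩ | ⟨j, k⟩
    · rfl
    · exact congrArg _ (key (j, τ) (.inl a) rfl)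
    · exact congrArg _ (key (j, P.parent k) (.inr ⟨k, rfl⟩) rfl))
  refine ⟨z, (hz _).trans (if_pos rfl), fun τ hτ => (hz _).trans (if_neg hτ), ?_⟩
  rintro ⟨j, τ⟩ (a | ⟨k, (rfl : P.parent k = τ)⟩)
  · exact hz _
  · exact hz _

theorem Generates.mem_utcPolytope {β : ∀ v : P.UDec, P.Choice v → ℝ} {z : P.Coord → ℝ}
    (hz : Generates β z) (hβ : ∀ v, β v ∈ stdSimplex ℝ (P.Choice v)) : z ∈ P.utcPolytope := by
  refine ⟨fun v => ?_, hz.root, hz.root_of_ne, fun e => ?_⟩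
  · simp only [hz.choice, ← sum_mul, (hβ v).2, one_mul]
  · induction e using coord_induction with
    | root τ =>
      by_cases h : τ = P.root
      · rw [h, hz.root]
        exact zero_le_one
      · rw [hz.root_of_ne τ h]
    | step v ih i =>
      rw [hz.choice]
      exact mul_nonneg ((hβ v).1 i) (arrival_nonneg ih)

end Coordinates

/-! ### Points of the UTC polytope act on strategies -/

section Polytope

variable {P : TreeFormDecisionProblem.{u}}

theorem flow_of_mem_utcPolytope {z : P.Coord → ℝ} (hz : z ∈ P.utcPolytope) (j : P.Dec)
    (τ : P.Seq) :
    z (.inl (P.parent j, τ)) + before (fun k => z (.inr (j, k))) τ =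
      ∑ a, z (.inl (P.child j a, τ)) + ∑ k : P.Next τ, z (.inr (j, k.1)) := by
  have := hz.1 (j, τ)
  rwa [Fintype.sum_sum_type, arrival, queryMass_eq_before] at this

theorem root_eq_single {z : P.Coord → ℝ} (hz : z ∈ P.utcPolytope) (τ : P.Seq) :
    z (.inl (P.root, τ)) = Pi.single (M := fun _ => ℝ) P.root 1 τ := by
  by_cases h : τ = P.root
  · rw [h, Pi.single_eq_same, hz.2.1]
  · rw [Pi.single_eq_of_ne h, hz.2.2.1 τ h]

/-- Conservation at `j` holds only after summing over `τ` against `x`: the mass entering through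
replies then cancels the mass leaving through queries, by `sum_before_mul`. -/
theorem isFlow_mulVec {z : P.Coord → ℝ} (hz : z ∈ P.utcPolytope) {x : P.Seq → ℝ}
    (hx : IsFlow x) : IsFlow ((devMatrix z).mulVec x) where
  root := by
    simp only [Matrix.mulVec, dotProduct, devMatrix, Matrix.of_apply, root_eq_single hz]
    simp [Pi.single_apply, hx.root]
  nonneg σ := sum_nonneg fun τ _ => mul_nonneg (hz.2.2.2 _) (hx.nonneg τ)
  sum_child j := by
    simp only [Matrix.mulVec, dotProduct, devMatrix, Matrix.of_apply]
    rw [sum_comm]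
    have h1 := fun τ => flow_of_mem_utcPolytope hz j τ
    have h2 := sum_before_mul hx fun k => z (.inr (j, k))
    simp only [← sum_mul]
    have h3 : ∀ τ, (∑ a, z (.inl (P.child j a, τ))) * x τ = z (.inl (P.parent j, τ)) * x τ +
        (before (fun k => z (.inr (j, k))) τ * x τ -
          (∑ k : P.Next τ, z (.inr (j, k.1))) * x τ) := by
      intro τ
      have := h1 τ
      rw [← sub_mul, ← add_mul]
      congr 1
      linarith
    rw [Fintype.sum_congr _ _ h3, sum_add_distrib, sum_sub_distrib, h2, sub_self, add_zero]

theorem choice_le_arrival {z : P.Coord → ℝ} (hz : z ∈ P.utcPolytope) (v : P.UDec)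
    (i : P.Choice v) : z (choiceCoord v i) ≤ arrival v z := by
  rw [hz.1 v]
  exact single_le_sum (f := fun i => z (choiceCoord v i)) (fun _ _ => hz.2.2.2 _) (mem_univ i)

/-- Choose a plan through `τ`. The mass at `(j, τ)` is at most the total mass observed at `p_j` over
the mediator states on the path to `τ`, and this is part of the entry at `p_j` of the image of a
flow. -/
theorem arrival_le_one {z : P.Coord → ℝ} (hz : z ∈ P.utcPolytope) (v : P.UDec) :
    arrival v z ≤ 1 := by
  obtain ⟨j, τ⟩ := v
  obtain ⟨plan, hplan⟩ := exists_plan_selected τ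
  -- `F` collects the path to `τ`: the reply mass at `(j, ka)` is a choice at `(j, p_k)`, so it is
  -- bounded by the arrival one mediator step earlier. The depth bound shows that each inserted
  -- sequence is new.
  have key : ∃ F : Finset P.Seq, (∀ τ' ∈ F, Selected plan τ' ∧ P.seqDepth τ' ≤ P.seqDepth τ) ∧
      arrival (j, τ) z ≤ ∑ τ' ∈ F, z (.inl (P.parent j, τ')) := by
    induction hplan with
    | root =>
      refine ⟨{P.root}, ?_, ?_⟩
      · simp [Selected.root]
      · simp [arrival, queryMass]
    | step k hk ih =>
      obtain ⟨F, hF, hle⟩ := ih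
      have hd : P.seqDepth (P.parent k) < P.seqDepth (P.child k (plan k)) := by
        rw [seqDepth_parent, seqDepth_child]
        exact Nat.lt_succ_self _
      refine ⟨insert (P.child k (plan k)) F, fun τ' h => ?_, ?_⟩
      · rcases mem_insert.1 h with rfl | h
        · exact ⟨.step k hk, le_rfl⟩
        · exact ⟨(hF _ h).1, (hF _ h).2.trans hd.le⟩
      · rw [sum_insert fun h => absurd (hF _ h).2 (not_le.2 hd)]
        exact add_le_add le_rfl
          ((choice_le_arrival hz (j, P.parent k) (.inr ⟨k, rfl⟩)).trans hle)
  obtain ⟨F, hF, hle⟩ := key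
  refine hle.trans ?_
  have hflow := isFlow_pureVector plan
  refine le_trans ?_ ((isFlow_mulVec hz hflow).le_one (P.parent j))
  have h1 : ∑ τ' ∈ F, z (.inl (P.parent j, τ')) =
      ∑ τ' ∈ F, z (.inl (P.parent j, τ')) * P.pureVector plan τ' :=
    sum_congr rfl fun τ' h => by rw [pureVector, if_pos (hF τ' h).1, mul_one]
  rw [h1]
  exact sum_le_univ_sum_of_nonneg fun τ' => mul_nonneg (hz.2.2.2 _) (hflow.nonneg τ')

/-- Linear deviations are given by points of the UTC polytope. -/
theorem exists_mem_utcPolytope_of_linear {φ : P.Deviation} (hφ : φ ∈ P.linearDeviations) :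
    ∃ z ∈ P.utcPolytope, ∀ x : P.X, φ x = (devMatrix z).mulVec x := by
  obtain ⟨hmem, L, hL⟩ := hφ
  have hflow := fun x => isFlow_of_mem_coX (hmem x)
  -- Each row of the matrix of `L` is replaced by its normal form, which is nonnegative because the
  -- row takes nonnegative values on `X`.
  choose b hb using fun σ => exists_isNormal_gauge (LinearMap.toMatrix' L σ)
  set A : P.Seq → P.Seq → ℝ := fun σ => LinearMap.toMatrix' L σ + gauge (b σ) with hA
  have hAx : ∀ σ, ∀ x : P.X, A σ ⬝ᵥ (x : P.Seq → ℝ) = φ x σ := by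
    intro σ x
    rw [hA, add_gauge_dotProduct (isFlow_of_mem_X x.2), hL]
    exact congrFun (LinearMap.toMatrix'_mulVec L x) σ
  have hA0 : ∀ σ τ, 0 ≤ A σ τ := fun σ => nonneg_of_isNormal (hb σ) fun x hx => by
    rw [hAx σ ⟨x, hx⟩]
    exact (hflow _).nonneg σ
  -- The sum of the rows `ja` need not be normal. `B j` is the shift that normalizes it, nonnegative
  -- because the summed rows are.
  choose B hB using fun j => exists_isNormal_gauge (∑ a, A (P.child j a))
  have hB0 : ∀ j k, 0 ≤ B j k := fun j => gauge_nonneg_of_isNormal (fun σ => by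
    rw [Finset.sum_apply]
    exact sum_nonneg fun a _ => hA0 _ _) (hB j)
  -- Both sides are normal and agree on strategies because images under `φ` are flows. Read
  -- entrywise, this equation is the UTC constraint.
  have hAB : ∀ j, A (P.parent j) = ∑ a, A (P.child j a) + gauge (B j) := by
    intro j
    refine (hb _).eq (hB j) fun x hx => ?_
    rw [add_gauge_dotProduct (isFlow_of_mem_X hx) (∑ a, A (P.child j a)), sum_dotProduct]
    refine (hAx _ ⟨x, hx⟩).trans (((hflow ⟨x, hx⟩).sum_child j).symm.trans ?_)
    exact Fintype.sum_congr _ _ fun a => (hAx _ ⟨x, hx⟩).symm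
  -- The indicator of the root is normal and equals one on every strategy, just as the root row
  -- does.
  have hroot : A P.root = Pi.single P.root 1 := by
    refine (hb _).eq ?_ fun x hx => ?_
    · exact fun k => ⟨fun a => by simp, Classical.arbitrary _, by simp⟩
    · rw [single_one_dotProduct, (isFlow_of_mem_X hx).root]
      exact (hAx _ ⟨x, hx⟩).trans (hflow _).root
  refine ⟨Sum.elim (fun p => A p.1 p.2) fun p => B p.1 p.2, ⟨?_, ?_, ?_, ?_⟩, ?_⟩
  · rintro ⟨j, τ⟩
    rw [Fintype.sum_sum_type, arrival, queryMass_eq_before]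
    have := congrFun (hAB j) τ
    simp only [Pi.add_apply, Finset.sum_apply, gauge] at this
    simp only [choiceCoord, Sum.elim_inl, Sum.elim_inr]
    linarith
  · simp [hroot]
  · intro τ hτ
    simp [hroot, hτ]
  · rintro (e | e)
    · exact hA0 _ _
    · exact hB0 _ _
  · intro x
    funext σ
    exact (hAx σ x).symm

end Polytope

/-! ### Pure deviators -/

section Deviators

variable {P : TreeFormDecisionProblem.{u}}

/-- The local strategies of a pure deviator. -/
def pointStrategy (s : P.PureDeviator) (v : P.UDec) : P.Choice v → ℝ := Pi.single (s v) 1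

theorem pointStrategy_mem (s : P.PureDeviator) (v : P.UDec) :
    pointStrategy s v ∈ stdSimplex ℝ (P.Choice v) :=
  single_mem_stdSimplex ℝ (s v)

/-- An arrival is a sum of at most two entries that are 0 or 1; `arrival_le_one` excludes the value
2. -/
theorem Generates.zero_or_one {s : P.PureDeviator} {z : P.Coord → ℝ}
    (hz : Generates (pointStrategy s) z) (e : P.Coord) : z e = 0 ∨ z e = 1 := by
  have hmem := hz.mem_utcPolytope (pointStrategy_mem s)
  induction e using coord_induction with
  | root τ =>
    rw [root_eq_single hmem, Pi.single_apply]
    split_ifs <;> simp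
  | step v ih i =>
    have harr : arrival v z = 0 ∨ arrival v z = 1 := by
      have h1 := arrival_le_one hmem v
      obtain ⟨j, _ | ⟨k, a⟩⟩ := v
      · simpa [arrival, queryMass] using ih _ (.observe j _)
      · have h2 := ih _ (.observe j _)
        have h3 := ih _ (.reply j k a)
        simp only [arrival, queryMass] at h1 ⊢
        rcases h2 with h2 | h2 <;> rcases h3 with h3 | h3 <;> rw [h2, h3] at h1 ⊢ <;>
          norm_num at h1 <;> norm_num
    rw [hz.choice, pointStrategy, Pi.single_apply]
    rcases harr with h | h <;> split_ifs <;> simp [h]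

theorem Generates.arrival_eq_one {s : P.PureDeviator} {z : P.Coord → ℝ}
    (hz : Generates (pointStrategy s) z) {e : P.Coord} {v : P.UDec} (hev : Feeds e v)
    (he : z e = 1) : arrival v z = 1 := by
  have hmem := hz.mem_utcPolytope (pointStrategy_mem s)
  refine le_antisymm (arrival_le_one hmem v) ?_
  cases hev with
  | observe j τ =>
    rw [arrival, he, queryMass_eq_before]
    rcases τ with _ | ⟨k, a⟩
    · simp
    · simpa using hmem.2.2.2 (.inr (j, k))
  | reply j k a =>
    have := hmem.2.2.2 (.inl (P.parent j, P.child k a))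
    simp only [arrival, queryMass]
    linarith

/-- A node of the UTC decision problem can be reached if the deviator and the mediator both play
towards it. -/
def nodeMass (z : P.Coord → ℝ) (x : P.Seq → ℝ) : P.UNode → ℝ
  | .obs σ τ => z (.inl (σ, τ)) * x τ
  | .dec j τ => arrival (j, τ) z * x τ
  | .query j k => z (.inr (j, k)) * x (P.parent k)

theorem Generates.nodeMass_of_reaches {s : P.PureDeviator} {z : P.Coord → ℝ}
    (hz : Generates (pointStrategy s) z) {x : P.X} {n : P.UNode} (h : Reaches s x n) :
    nodeMass z x n = 1 := by
  obtain ⟨x, plan, rfl⟩ := x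
  have key : ∀ {a : ℝ} {σ}, (a = 0 ∨ a = 1) → a * P.pureVector plan σ = 1 →
      a = 1 ∧ P.pureVector plan σ = 1 := by
    rintro a σ (rfl | rfl) h
    · simp at h
    · exact ⟨rfl, by simpa using h⟩
  have hone : ∀ v, arrival v z * P.pureVector plan v.2 = 1 →
      arrival v z = 1 ∧ P.pureVector plan v.2 = 1 := by
    intro v h
    rcases pureVector_zero_or_one plan v.2 with h0 | h0 <;> rw [h0] at h ⊢
    · simp at h
    · exact ⟨by simpa using h, rfl⟩
  induction h with
  | root => simp [nodeMass, hz.root, pureVector_root]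
  | observe j τ _ ih =>
    obtain ⟨h1, h2⟩ := key (hz.zero_or_one _) ih
    simp only [nodeMass, hz.arrival_eq_one (.observe j τ) h1, h2, mul_one]
  | play j τ a _ hs ih =>
    obtain ⟨h1, h2⟩ := hone (j, τ) ih
    have := hz.choice (j, τ) (.inl a)
    rw [pointStrategy, hs, Pi.single_eq_same, h1, mul_one] at this
    simp only [choiceCoord] at this
    simpa [nodeMass, this] using h2
  | ask j τ k _ hs ih =>
    obtain ⟨h1, h2⟩ := hone (j, τ) ih
    have := hz.choice (j, τ) (.inr k)
    rw [pointStrategy, hs, Pi.single_eq_same, h1, mul_one] at this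
    simp only [choiceCoord] at this
    simpa [nodeMass, this, k.2] using h2
  | reply j k a _ hx ih =>
    obtain ⟨h1, h2⟩ := key (hz.zero_or_one _) ih
    simp only [nodeMass, hz.arrival_eq_one (.reply j k a) h1]
    simpa using hx

/-- The inductive step for arrivals, with the claim about feeding coordinates as a hypothesis. If
the mass comes from a query of `k`, the mediator also reaches `p_k`, since `x` is one at `ka`. -/
theorem Generates.reaches_dec {s : P.PureDeviator} {z : P.Coord → ℝ}
    (hz : Generates (pointStrategy s) z) {x : P.X} {v : P.UDec}
    (ih : ∀ e, Feeds e v → (∀ σ τ, e = .inl (σ, τ) → z e = 1 → (x : P.Seq → ℝ) τ = 1 →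
        Reaches s x (.obs σ τ)) ∧
      (∀ j k, e = .inr (j, k) → z e = 1 → (x : P.Seq → ℝ) (P.parent k) = 1 →
        Reaches s x (.query j k)))
    (hv : arrival v z ≠ 0) (hx : (x : P.Seq → ℝ) v.2 = 1) : Reaches s x (.dec v.1 v.2) := by
  obtain ⟨j, τ⟩ := v
  rcases hz.zero_or_one (.inl (P.parent j, τ)) with h | h
  · rcases τ with _ | ⟨k, a⟩
    · simp [arrival, queryMass, h] at hv
    · have h1 : z (.inr (j, k)) = 1 :=
        (hz.zero_or_one _).resolve_left (by simpa [arrival, queryMass, h] using hv)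
      refine .reply j k a ((ih _ (.reply j k a)).2 j k rfl h1 ?_) hx
      have hflow := isFlow_of_mem_X x.2
      exact le_antisymm (hflow.le_one _) (hx.symm.le.trans (hflow.child_le k a))
  · exact .observe j τ ((ih _ (.observe j τ)).1 _ _ rfl h hx)

/-- Converse of `Generates.nodeMass_of_reaches`. The claims for entries of `A` and of `B` feed each
other, so one induction over coordinates proves both. -/
theorem Generates.reaches_of_eq_one {s : P.PureDeviator} {z : P.Coord → ℝ}
    (hz : Generates (pointStrategy s) z) {x : P.X} (e : P.Coord) :
    (∀ σ τ, e = .inl (σ, τ) → z e = 1 → (x : P.Seq → ℝ) τ = 1 → Reaches s x (.obs σ τ)) ∧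
      (∀ j k, e = .inr (j, k) → z e = 1 → (x : P.Seq → ℝ) (P.parent k) = 1 →
        Reaches s x (.query j k)) := by
  induction e using coord_induction with
  | root τ =>
    refine ⟨fun σ τ' he h1 _ => ?_, fun j k he => by simp at he⟩
    simp only [Sum.inl.injEq, Prod.mk.injEq] at he
    obtain ⟨rfl, rfl⟩ := he
    by_cases h : τ = P.root
    · rw [h]
      exact .root
    · rw [hz.root_of_ne τ h] at h1
      simp at h1
  | step v ih i =>
    have key : z (choiceCoord v i) = 1 → s v = i ∧ arrival v z ≠ 0 := by
      rw [hz.choice, pointStrategy, Pi.single_apply]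
      split_ifs with h
      · intro h1
        exact ⟨h.symm, fun h2 => by simp [h2] at h1⟩
      · simp
    have hdec := hz.reaches_dec (x := x) ih
    obtain ⟨j, τ⟩ := v
    rcases i with a | ⟨k, (rfl : P.parent k = τ)⟩
    · refine ⟨fun σ τ' he h1 hx => ?_, fun j k he => by simp [choiceCoord] at he⟩
      simp only [choiceCoord, Sum.inl.injEq, Prod.mk.injEq] at he
      obtain ⟨rfl, rfl⟩ := he
      obtain ⟨hs, harr⟩ := key h1
      exact .play j τ a (hdec harr hx) hs
    · refine ⟨fun σ τ he => by simp [choiceCoord] at he, fun j' k' he h1 hx => ?_⟩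
      simp only [choiceCoord, Sum.inr.injEq, Prod.mk.injEq] at he
      obtain ⟨rfl, rfl⟩ := he
      obtain ⟨hs, harr⟩ := key h1
      exact .ask j _ ⟨k, rfl⟩ (hdec harr hx) hs

/-- Pure deviators act by the matrices that they generate. -/
theorem Generates.pureDeviation_eq {s : P.PureDeviator} {z : P.Coord → ℝ}
    (hz : Generates (pointStrategy s) z) (x : P.X) :
    pureDeviation s x = (devMatrix z).mulVec x := by
  have hmem := hz.mem_utcPolytope (pointStrategy_mem s)
  have hx := isFlow_of_mem_X x.2
  funext σ
  have hle := (isFlow_mulVec hmem hx).le_one σ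
  have hsum : (devMatrix z).mulVec x σ = ∑ τ, nodeMass z x (.obs σ τ) := rfl
  have hnn : ∀ τ, 0 ≤ nodeMass z (x : P.Seq → ℝ) (.obs σ τ) := fun τ =>
    mul_nonneg (hmem.2.2.2 _) (hx.nonneg τ)
  unfold pureDeviation
  split_ifs with h
  · obtain ⟨τ, h⟩ := h
    refine le_antisymm ?_ hle
    -- One mediator state already contributes mass one to the row, while the whole row has mass at
    -- most one.
    rw [hsum, ← hz.nodeMass_of_reaches h]
    exact single_le_sum (f := fun τ => nodeMass z (x : P.Seq → ℝ) (.obs σ τ)) (fun τ _ => hnn τ)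
      (mem_univ τ)
  · rw [hsum]
    refine (sum_eq_zero fun τ _ => ?_).symm
    obtain ⟨_, plan, rfl⟩ := x
    rcases hz.zero_or_one (.inl (σ, τ)) with h0 | h1
    · rw [nodeMass, h0, zero_mul]
    · rcases pureVector_zero_or_one plan τ with hx0 | hx1
      · exact mul_eq_zero_of_right _ hx0
      · exact absurd ⟨τ, (hz.reaches_of_eq_one _).1 σ τ rfl h1 hx1⟩ h

theorem pureDeviation_mem_X (s : P.PureDeviator) (x : P.X) : pureDeviation s x ∈ P.X := by
  obtain ⟨z, hz⟩ := exists_generates (pointStrategy s)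
  have hflow : IsFlow (pureDeviation s x) := by
    rw [hz.pureDeviation_eq]
    exact isFlow_mulVec (hz.mem_utcPolytope (pointStrategy_mem s)) (isFlow_of_mem_X x.2)
  refine hflow.mem_X fun σ => ?_
  unfold pureDeviation
  split_ifs <;> simp

theorem apply_mem_coX_of_utcDeviation {φ : P.Deviation} (hφ : φ ∈ P.utcDeviations) (x : P.X) :
    φ x ∈ P.coX := by
  obtain ⟨μ, hμ, rfl⟩ := hφ
  rw [Finset.sum_apply]
  exact (convex_convexHull ℝ P.X).sum_mem (fun s _ => hμ.1 s) hμ.2 fun s _ =>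
    subset_convexHull ℝ _ (pureDeviation_mem_X s x)

end Deviators

/-! ### Mixed and behavioral deviators -/

section Kuhn

/-- The product of local distributions, as a distribution on functions. -/
theorem prod_mem_stdSimplex {ι : Type*} [Fintype ι] [DecidableEq ι] {κ : ι → Type*}
    [∀ i, Fintype (κ i)] {β : ∀ i, κ i → ℝ} (hβ : ∀ i, β i ∈ stdSimplex ℝ (κ i)) :
    (fun s : ∀ i, κ i => ∏ i, β i (s i)) ∈ stdSimplex ℝ (∀ i, κ i) := by
  refine ⟨fun s => prod_nonneg fun i _ => (hβ i).1 _, ?_⟩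
  rw [← Fintype.prod_sum]
  exact prod_eq_one fun i _ => (hβ i).2

/-- Under a product distribution, the `i`-th coordinate is independent of what does not depend on
it. -/
theorem sum_prod_mul_single {ι : Type*} [Fintype ι] [DecidableEq ι] {κ : ι → Type*}
    [∀ i, Fintype (κ i)] [∀ i, DecidableEq (κ i)] {β : ∀ i, κ i → ℝ}
    (hβ : ∀ i, ∑ a, β i a = 1) (i : ι) (c : κ i) (f : (∀ i, κ i) → ℝ)
    (hf : ∀ s a, f (Function.update s i a) = f s) :
    ∑ s, (∏ i, β i (s i)) * (Pi.single (M := fun _ => ℝ) (s i) 1 c * f s) =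
      β i c * ∑ s, (∏ i, β i (s i)) * f s := by
  have hupd : ∀ (s : ∀ i, κ i) a, (∏ k, β k (Function.update s i a k)) * β i (s i) =
      (∏ k, β k (s k)) * β i a := by
    intro s a
    rw [← mul_prod_erase univ _ (mem_univ i), ← mul_prod_erase univ (fun k => β k (s k))
      (mem_univ i), Function.update_self]
    have : ∏ k ∈ univ.erase i, β k (Function.update s i a k) = ∏ k ∈ univ.erase i, β k (s k) :=
      prod_congr rfl fun k hk => by rw [Function.update_of_ne (ne_of_mem_erase hk)]
    rw [this]
    ring
  -- Resampling: exchanging the `i`-th coordinate with an independent copy preserves the product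
  -- weight and leaves `f` unchanged.
  let e : (∀ i, κ i) × κ i ≃ (∀ i, κ i) × κ i :=
    { toFun := fun p => (Function.update p.1 i p.2, p.1 i)
      invFun := fun p => (Function.update p.1 i p.2, p.1 i)
      left_inv := fun p => by simp
      right_inv := fun p => by simp }
  calc ∑ s, (∏ i, β i (s i)) * (Pi.single (M := fun _ => ℝ) (s i) 1 c * f s)
      = ∑ p : (∀ i, κ i) × κ i, (∏ k, β k (p.1 k)) * β i p.2 *
          (Pi.single (M := fun _ => ℝ) (p.1 i) 1 c * f p.1) := by
        rw [Fintype.sum_prod_type]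
        refine Fintype.sum_congr _ _ fun s => ?_
        simp only [← sum_mul, ← mul_sum, hβ, mul_one]
    _ = ∑ p : (∀ i, κ i) × κ i, (∏ k, β k (p.1 k)) * β i p.2 *
          (Pi.single (M := fun _ => ℝ) p.2 1 c * f p.1) := by
        rw [← e.sum_comp]
        refine Fintype.sum_congr _ _ fun p => ?_
        simp only [e, Equiv.coe_fn_mk, hupd, Function.update_self, hf]
    _ = ∑ s, β i c * ((∏ i, β i (s i)) * f s) := by
        rw [Fintype.sum_prod_type]
        refine Fintype.sum_congr _ _ fun s => ?_
        rw [Fintype.sum_eq_single c fun a ha => by rw [Pi.single_eq_of_ne ha.symm]; ring]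
        rw [Pi.single_eq_same]
        ring
    _ = _ := by rw [mul_sum]

variable {P : TreeFormDecisionProblem.{u}}

/-- Causality: entries of depth at most `n` are determined by the choices at decision points of
depth less than `n`. -/
theorem Generates.congr_of_depth_le {β β' : ∀ v : P.UDec, P.Choice v → ℝ} {z z' : P.Coord → ℝ}
    (hz : Generates β z) (hz' : Generates β' z') {n : ℕ}
    (h : ∀ v, P.decDepth v < n → β v = β' v) (e : P.Coord) (he : P.coordDepth e ≤ n) :
    z e = z' e := by
  induction e using coord_induction with
  | root τ =>
    by_cases hτ : τ = P.root
    · rw [hτ, hz.root, hz'.root]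
    · rw [hz.root_of_ne τ hτ, hz'.root_of_ne τ hτ]
  | step v ih i =>
    rw [coordDepth_choiceCoord] at he
    rw [hz.choice, hz'.choice, h v he, arrival_congr fun e hev => ih e hev ?_]
    rw [hev.coordDepth_eq]
    omega

/-- Behavioral deviators are mixed deviators. -/
theorem Generates.mem_utcDeviations {β : ∀ v : P.UDec, P.Choice v → ℝ} {z : P.Coord → ℝ}
    (hz : Generates β z) (hβ : ∀ v, β v ∈ stdSimplex ℝ (P.Choice v)) :
    (fun x : P.X => (devMatrix z).mulVec x) ∈ P.utcDeviations := by
  have hμ := prod_mem_stdSimplex hβ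
  choose Z hZ using fun s : P.PureDeviator => exists_generates (pointStrategy s)
  have hmean : ∀ e, ∑ s : P.PureDeviator, (∏ v, β v (s v)) * Z s e = z e := by
    intro e
    induction e using coord_induction with
    | root τ =>
      by_cases hτ : τ = P.root
      · simp only [hτ, (hZ _).root, hz.root, mul_one]
        exact hμ.2
      · simp only [(hZ _).root_of_ne τ hτ, hz.root_of_ne τ hτ, mul_zero, sum_const_zero]
    | step v ih i =>
      simp only [(hZ _).choice, hz.choice, pointStrategy]
      -- The factor `arrival v (Z s)` does not depend on the choice of `s` at `v`, so the
      -- expectation of the product factors; linearity of `arrival v` then allows induction.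
      rw [sum_prod_mul_single (fun v => (hβ v).2) v i fun s => arrival v (Z s)]
      · congr 1
        rw [← arrival_congr ih]
        let A := (isLinearMap_arrival v).mk'
        have hA : ∀ y, arrival v y = A y := fun _ => rfl
        have : (fun e => ∑ s : P.PureDeviator, (∏ v, β v (s v)) * Z s e) =
            ∑ s : P.PureDeviator, (∏ v, β v (s v)) • Z s := by
          funext e
          simp
        rw [this, hA, map_sum]
        simp only [map_smul, smul_eq_mul, hA]
      · intro s a
        refine arrival_congr fun e he => (hZ _).congr_of_depth_le (hZ _) (n := P.decDepth v)
          (fun u hu => ?_) e he.coordDepth_eq.le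
        rw [pointStrategy, pointStrategy, Function.update_of_ne]
        rintro rfl
        exact lt_irrefl _ hu
  refine ⟨_, hμ, funext fun x => ?_⟩
  rw [Finset.sum_apply]
  simp only [Pi.smul_apply, (hZ _).pureDeviation_eq]
  funext σ
  simp only [Matrix.mulVec, dotProduct, devMatrix, Matrix.of_apply, Finset.sum_apply,
    Pi.smul_apply, smul_eq_mul, ← hmean, sum_mul, mul_sum]
  rw [sum_comm]
  simp only [mul_assoc]

/-- Pure strategies are handled by the mixed deviator; the linear preimage of a convex set is convex
and so contains the hull. -/
theorem Generates.mapsTo_coX {β : ∀ v : P.UDec, P.Choice v → ℝ} {z : P.Coord → ℝ}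
    (hz : Generates β z) (hβ : ∀ v, β v ∈ stdSimplex ℝ (P.Choice v)) :
    Set.MapsTo (devMatrix z).mulVec P.coX P.coX := by
  have h : P.coX ⊆ (devMatrix z).mulVecLin ⁻¹' P.coX :=
    convexHull_min (fun x hx => apply_mem_coX_of_utcDeviation (hz.mem_utcDeviations hβ) ⟨x, hx⟩)
      ((convex_convexHull ℝ P.X).linear_preimage _)
  exact fun x hx => h hx

end Kuhn

end TreeFormDecisionProblem

/-! ### Regret matching -/

section RegretMatching

theorem history_succ {ι : Type u} (g : ℕ → ι → ℝ) (t : ℕ) : history g (t + 1) = history g t ++ [g t] := by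
  simp [history, List.range_succ]

variable {ι : Type u} [Fintype ι]

/-- The strategy that is proportional to the positive parts of the regrets. -/
noncomputable def regretStrategy (r : ι → ℝ) (i : ι) : ℝ :=
  if ∑ k, max (r k) 0 = 0 then (Fintype.card ι : ℝ)⁻¹ else max (r i) 0 / ∑ k, max (r k) 0

theorem regretStrategy_mem [Nonempty ι] (r : ι → ℝ) : regretStrategy r ∈ stdSimplex ℝ ι := by
  constructor
  · intro i
    unfold regretStrategy
    split_ifs
    · positivity
    · exact div_nonneg (le_max_right _ _) (sum_nonneg fun _ _ => le_max_right _ _)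
  · unfold regretStrategy
    split_ifs with h
    · simp
    · rw [← sum_div, div_self h]

/-- The regrets after a list of utility vectors. -/
noncomputable def cumulativeRegret (l : List (ι → ℝ)) : ι → ℝ :=
  l.foldl (fun r g i => r i + (g i - g ⬝ᵥ regretStrategy r)) 0

theorem cumulativeRegret_history_succ (g : ℕ → ι → ℝ) (t : ℕ) (i : ι) :
    cumulativeRegret (history g (t + 1)) i = cumulativeRegret (history g t) i +
      (g t i - g t ⬝ᵥ regretStrategy (cumulativeRegret (history g t))) := by
  simp [history_succ, cumulativeRegret]

/-- Blackwell's condition: the strategy is proportional to the positive parts of the regrets, so the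
next increment is orthogonal to them. -/
theorem sum_max_mul_regret (r g : ι → ℝ) :
    ∑ i, max (r i) 0 * (g i - g ⬝ᵥ regretStrategy r) = 0 := by
  by_cases h : ∑ k, max (r k) 0 = 0
  · have h0 := (sum_eq_zero_iff_of_nonneg fun k _ => le_max_right (r k) 0).1 h
    exact sum_eq_zero fun i hi => by rw [h0 i hi, zero_mul]
  · have hs : (∑ k, max (r k) 0) * (g ⬝ᵥ regretStrategy r) = ∑ i, max (r i) 0 * g i := by
      rw [dotProduct, mul_sum]
      refine Fintype.sum_congr _ _ fun i => ?_
      rw [regretStrategy, if_neg h]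
      field_simp
    simp only [mul_sub, sum_sub_distrib, ← sum_mul, hs, sub_self]

theorem max_add_sq_le (a b : ℝ) : max (a + b) 0 ^ 2 ≤ max a 0 ^ 2 + 2 * (max a 0 * b) + b ^ 2 := by
  have h : max (a + b) 0 ^ 2 ≤ (max a 0 + b) ^ 2 := by
    rcases le_total (a + b) 0 with h | h
    · rw [max_eq_right h, zero_pow two_ne_zero]
      exact sq_nonneg _
    · rw [max_eq_left h]
      exact pow_le_pow_left₀ h (add_le_add (le_max_left _ _) le_rfl) 2
  linarith [add_sq (max a 0) b]

theorem dotProduct_mem_Icc {g y : ι → ℝ} (hg : ∀ i, g i ∈ Set.Icc (0 : ℝ) 1)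
    (hy : y ∈ stdSimplex ℝ ι) : g ⬝ᵥ y ∈ Set.Icc (0 : ℝ) 1 := by
  refine ⟨sum_nonneg fun i _ => mul_nonneg (hg i).1 (hy.1 i), ?_⟩
  rw [← hy.2]
  exact sum_le_sum fun i _ => mul_le_of_le_one_left (hy.1 i) (hg i).2

/-- The cross term vanishes by `sum_max_mul_regret`, so each step adds at most one for each choice.
-/
theorem sum_sq_cumulativeRegret_le [Nonempty ι] {g : ℕ → ι → ℝ}
    (hg : ∀ t i, g t i ∈ Set.Icc (0 : ℝ) 1) (T : ℕ) :
    ∑ i, max (cumulativeRegret (history g T) i) 0 ^ 2 ≤ Fintype.card ι * T := by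
  induction T with
  | zero => simp [history, cumulativeRegret]
  | succ t ih =>
    set r := cumulativeRegret (history g t)
    have hx := dotProduct_mem_Icc (hg t) (regretStrategy_mem r)
    have hδ : ∀ i, (g t i - g t ⬝ᵥ regretStrategy r) ^ 2 ≤ 1 := fun i => by
      have := hg t i
      rw [sq_le_one_iff_abs_le_one, abs_le]
      constructor <;> linarith [this.1, this.2, hx.1, hx.2]
    simp only [cumulativeRegret_history_succ]
    calc _ ≤ ∑ i, (max (r i) 0 ^ 2 + 2 * (max (r i) 0 * (g t i - g t ⬝ᵥ regretStrategy r)) + 1) :=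
          sum_le_sum fun i _ => (max_add_sq_le _ _).trans (add_le_add le_rfl (hδ i))
      _ = ∑ i, max (r i) 0 ^ 2 + Fintype.card ι := by
          rw [sum_add_distrib, sum_add_distrib, ← mul_sum, sum_max_mul_regret]
          simp
      _ ≤ _ := by
          push_cast
          linarith

theorem exists_localMinimizer (ι : Type u) [Fintype ι] [Nonempty ι] :
    ∃ R : LocalMinimizer ι, R.HasRegret fun T => (Fintype.card ι : ℝ) * Real.sqrt T := by
  refine ⟨⟨fun l => regretStrategy (cumulativeRegret l), fun l => regretStrategy_mem _⟩, ?_⟩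
  intro g hg T y hy
  have hR : ∀ i, cumulativeRegret (history g T) i ≤ Fintype.card ι * Real.sqrt T := by
    intro i
    refine (le_max_left _ 0).trans (abs_le_of_sq_le_sq' ?_ (by positivity)).2
    calc max (cumulativeRegret (history g T) i) 0 ^ 2
        ≤ ∑ i, max (cumulativeRegret (history g T) i) 0 ^ 2 :=
          single_le_sum (f := fun i => max (cumulativeRegret (history g T) i) 0 ^ 2)
            (fun _ _ => sq_nonneg _) (mem_univ i)
      _ ≤ Fintype.card ι * T := sum_sq_cumulativeRegret_le hg T
      -- A factor `√n` is given away here: regret matching achieves `√(n T)`, but `n √T` is the rate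
      -- that is claimed.
      _ ≤ Fintype.card ι * (Fintype.card ι * T) := by
          have : (1 : ℝ) ≤ Fintype.card ι := by exact_mod_cast Fintype.card_pos
          exact mul_le_mul_of_nonneg_left (le_mul_of_one_le_left (by positivity) this)
            (by positivity)
      _ = _ := by rw [mul_pow, Real.sq_sqrt (by positivity)]; ring
  have hsum : ∀ T, ∑ t ∈ range T, g t ⬝ᵥ (y - regretStrategy (cumulativeRegret (history g t))) =
      ∑ i, y i * cumulativeRegret (history g T) i := by
    intro T
    induction T with
    | zero => simp [history, cumulativeRegret]
    | succ t ih =>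
      rw [sum_range_succ, ih]
      simp only [cumulativeRegret_history_succ, mul_add, mul_sub, sum_add_distrib,
        sum_sub_distrib, ← sum_mul, hy.2, one_mul, dotProduct_sub]
      rw [dotProduct_comm]
      rfl
  refine (hsum T).le.trans ?_
  calc ∑ i, y i * cumulativeRegret (history g T) i
      ≤ ∑ i, y i * (Fintype.card ι * Real.sqrt T) :=
        sum_le_sum fun i _ => mul_le_mul_of_nonneg_left (hR i) (hy.1 i)
    _ = _ := by rw [← sum_mul, hy.2, one_mul]

/-- Zero utilities cause zero regret. -/
theorem LocalMinimizer.HasRegret.nonneg {R : LocalMinimizer ι} {ρ : ℕ → ℝ} (h : R.HasRegret ρ)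
    (T : ℕ) : 0 ≤ ρ T := by
  simpa using h (fun _ _ => 0) (fun _ _ => by simp) T _ (R.next_mem [])

end RegretMatching

/-! ### Fixed points of linear maps -/

/-- The Markov–Kakutani theorem for one map: averages of an orbit accumulate at a fixed point. -/
theorem ContinuousLinearMap.exists_fixed_of_mapsTo {E : Type*} [NormedAddCommGroup E]
    [NormedSpace ℝ E] (f : E →L[ℝ] E) {K : Set E} (hK : IsCompact K) (hconv : Convex ℝ K)
    (hne : K.Nonempty) (hf : Set.MapsTo f K K) : ∃ x ∈ K, f x = x := by
  obtain ⟨x₀, hx₀⟩ := hne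
  have horb : ∀ n, f^[n] x₀ ∈ K := fun n => hf.iterate n hx₀
  let y : ℕ → E := fun n => ((n : ℝ) + 1)⁻¹ • ∑ i ∈ range (n + 1), f^[i] x₀
  have hy : ∀ n, y n ∈ K := by
    intro n
    simp only [y, smul_sum]
    refine hconv.sum_mem (fun _ _ => by positivity) ?_ fun i _ => horb i
    rw [sum_const, card_range, nsmul_eq_mul]
    push_cast
    field_simp
  obtain ⟨a, ha, φ, hφ, hlim⟩ := hK.tendsto_subseq hy
  refine ⟨a, ha, ?_⟩
  -- Applying `f` shifts the orbit, so all but the two end terms of the average cancel, leaving an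
  -- error of order `1 / n`.
  have hdiff : ∀ n, f (y n) - y n = ((n : ℝ) + 1)⁻¹ • (f^[n + 1] x₀ - x₀) := by
    intro n
    simp only [y, map_smul, map_sum, ← smul_sub, ← sum_sub_distrib]
    congr 1
    simp only [← Function.iterate_succ_apply' f]
    exact sum_range_sub (fun i => f^[i] x₀) (n + 1)
  obtain ⟨C, hC⟩ := hK.isBounded.exists_norm_le
  have hzero : Filter.Tendsto (fun n => f (y n) - y n) Filter.atTop (nhds 0) := by
    refine squeeze_zero_norm (a := fun n : ℕ => (1 / ((n : ℝ) + 1)) * (C + C)) (fun n => ?_) ?_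
    · rw [hdiff, norm_smul, one_div, Real.norm_of_nonneg (by positivity)]
      refine mul_le_mul_of_nonneg_left ?_ (by positivity)
      exact (norm_sub_le _ _).trans (add_le_add (hC _ (horb _)) (hC _ hx₀))
    · simpa using (tendsto_one_div_add_atTop_nhds_zero_nat (𝕜 := ℝ)).mul_const (C + C)
  have h1 := hzero.comp hφ.tendsto_atTop
  have h2 : Filter.Tendsto ((fun n => f (y n) - y n) ∘ φ) Filter.atTop (nhds (f a - a)) :=
    ((f.continuous.tendsto a).comp hlim).sub hlim
  exact sub_eq_zero.1 (tendsto_nhds_unique h2 h1)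

namespace TreeFormDecisionProblem

theorem exists_isFixedPointOracle (P : TreeFormDecisionProblem.{u}) :
    ∃ fixpt : Matrix P.Seq P.Seq ℝ → P.Seq → ℝ, IsFixedPointOracle fixpt := by
  have h : ∀ M : Matrix P.Seq P.Seq ℝ, ∃ x, Set.MapsTo M.mulVec P.coX P.coX →
      x ∈ P.coX ∧ M.mulVec x = x := by
    intro M
    by_cases hM : Set.MapsTo M.mulVec P.coX P.coX
    · obtain ⟨x, hx, hfix⟩ := (LinearMap.toContinuousLinearMap M.mulVecLin).exists_fixed_of_mapsTo
        (K := P.coX) ((Set.finite_range P.pureVector).isCompact_convexHull (𝕜 := ℝ)) (convex_convexHull ℝ _)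
        ⟨_, subset_convexHull ℝ _ ⟨fun _ => Classical.arbitrary _, rfl⟩⟩ hM
      exact ⟨x, fun _ => ⟨hx, hfix⟩⟩
    · exact ⟨0, fun h => absurd h hM⟩
  choose fixpt hfix using h
  exact ⟨fixpt, hfix⟩

/-! ### The chain of scaled extensions -/

section Chain

variable {P : TreeFormDecisionProblem.{u}}

/-- The coordinates of the choices at `v`. -/
def choiceCoords (v : P.UDec) : Finset P.Coord := univ.image (choiceCoord v)

theorem mem_choiceCoords {v : P.UDec} {e : P.Coord} :
    e ∈ choiceCoords v ↔ ∃ i, choiceCoord v i = e := by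
  simp [choiceCoords]

theorem choiceCoord_notMem {u v : P.UDec} (h : u ≠ v) (i : P.Choice u) :
    choiceCoord u i ∉ choiceCoords v := by
  rw [mem_choiceCoords]
  rintro ⟨i', hi⟩
  exact h (congrArg Sigma.fst (choiceCoord_injective (a₁ := ⟨u, i⟩) (a₂ := ⟨v, i'⟩) hi.symm))

theorem root_notMem_choiceCoords (v : P.UDec) (τ : P.Seq) :
    (.inl (P.root, τ) : P.Coord) ∉ choiceCoords v := by
  rw [mem_choiceCoords]
  rintro ⟨i, hi⟩
  exact choiceCoord_ne_root v i τ hi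

/-- In an order of increasing depth, appending the block of `v` changes neither the scaling of `v`
nor any constraint imposed earlier. -/
theorem Feeds.notMem_choiceCoords {e : P.Coord} {u v : P.UDec} (he : Feeds e u)
    (h : P.decDepth u ≤ P.decDepth v) : e ∉ choiceCoords v := by
  rw [mem_choiceCoords]
  rintro ⟨i, rfl⟩
  have := he.coordDepth_eq
  rw [coordDepth_choiceCoord] at this
  omega

theorem sum_choiceCoords (v : P.UDec) (z : P.Coord → ℝ) :
    ∑ e ∈ choiceCoords v, z e = ∑ i, z (choiceCoord v i) :=
  sum_image fun i _ i' _ h =>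
    eq_of_heq (Sigma.mk.inj (choiceCoord_injective (a₁ := ⟨v, i⟩) (a₂ := ⟨v, i'⟩) h)).2

theorem mem_rootCoords {e : P.Coord} : e ∈ P.rootCoords ↔ ∃ τ, e = .inl (P.root, τ) := by
  simp [rootCoords, eq_comm]

/-- The coordinates that are available after the decision points in `l`. -/
def coordsUpTo (l : List P.UDec) : Finset P.Coord :=
  P.rootCoords ∪ l.toFinset.biUnion choiceCoords

/-- The points that satisfy the constraints of the decision points in `l`. -/
def polytopeUpTo (l : List P.UDec) : Set (P.Coord → ℝ) :=
  {z | (∀ v ∈ l, arrival v z = ∑ i, z (choiceCoord v i)) ∧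
    z (.inl (P.root, P.root)) = 1 ∧
    (∀ τ, τ ≠ P.root → z (.inl (P.root, τ)) = 0) ∧
    (∀ e, 0 ≤ z e) ∧ ∀ e ∉ coordsUpTo l, z e = 0}

theorem coordsUpTo_append (l : List P.UDec) (v : P.UDec) :
    coordsUpTo (l ++ [v]) = coordsUpTo l ∪ choiceCoords v := by
  ext e
  simp only [coordsUpTo, mem_union, mem_biUnion, List.mem_toFinset, List.mem_append,
    List.mem_singleton]
  constructor
  · rintro (h | ⟨u, h | rfl, he⟩)
    · exact .inl (.inl h)
    · exact .inl (.inr ⟨u, h, he⟩)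
    · exact .inr he
  · rintro ((h | ⟨u, h, he⟩) | h)
    · exact .inl h
    · exact .inr ⟨u, .inl h, he⟩
    · exact .inr ⟨v, .inr rfl, h⟩

theorem disjoint_coordsUpTo {l : List P.UDec} {v : P.UDec} (hv : v ∉ l) :
    Disjoint (coordsUpTo l) (choiceCoords v) := by
  rw [Finset.disjoint_left]
  intro e he
  simp only [coordsUpTo, mem_union, mem_rootCoords, mem_biUnion, List.mem_toFinset] at he
  rcases he with ⟨τ, rfl⟩ | ⟨u, hu, he⟩
  · exact root_notMem_choiceCoords v τ
  · obtain ⟨i, rfl⟩ := mem_choiceCoords.1 he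
    exact choiceCoord_notMem (by rintro rfl; exact hv hu) i

theorem choiceCoords_nonempty (v : P.UDec) : (choiceCoords v).Nonempty :=
  univ_nonempty.image _

theorem polytopeUpTo_nil : polytopeUpTo (P := P) [] = {P.rootPoint} := by
  ext z
  rw [Set.mem_singleton_iff]
  constructor
  · rintro ⟨-, h1, h2, -, h3⟩
    funext e
    by_cases he : e ∈ P.rootCoords
    · obtain ⟨τ, rfl⟩ := mem_rootCoords.1 he
      by_cases hτ : τ = P.root
      · rw [hτ, h1, rootPoint, Pi.single_eq_same]
      · rw [h2 τ hτ, rootPoint, Pi.single_eq_of_ne]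
        simpa using hτ
    · rw [h3 e (by simpa [coordsUpTo] using he), rootPoint, Pi.single_eq_of_ne]
      rintro rfl
      exact he (mem_rootCoords.2 ⟨_, rfl⟩)
  · rintro rfl
    refine ⟨by simp, by simp [rootPoint], fun τ hτ => ?_, fun e => ?_, fun e he => ?_⟩
    · rw [rootPoint, Pi.single_eq_of_ne]
      simpa using hτ
    · rw [rootPoint, Pi.single_apply]
      split_ifs <;> simp
    · rw [rootPoint, Pi.single_eq_of_ne]
      rintro rfl
      exact he (mem_union_left _ (mem_rootCoords.2 ⟨_, rfl⟩))

/-- Divide by the total; if it is zero any vertex serves. The lemma also supplies the local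
comparator in the regret bound. -/
theorem exists_simplex_scaling {E : Type*} [DecidableEq E] {G : Finset E} (hG : G.Nonempty)
    {z : E → ℝ} (hz : ∀ e, 0 ≤ z e) : ∃ w : E → ℝ, (∀ e, 0 ≤ w e) ∧ (∀ e ∉ G, w e = 0) ∧
      ∑ e ∈ G, w e = 1 ∧ ∀ e ∈ G, z e = (∑ e ∈ G, z e) * w e := by
  have hs : 0 ≤ ∑ e ∈ G, z e := sum_nonneg fun e _ => hz e
  by_cases h : ∑ e ∈ G, z e = 0
  · obtain ⟨e₀, he₀⟩ := hG
    refine ⟨Pi.single e₀ 1, fun e => ?_, fun e he => ?_, ?_, fun e he => ?_⟩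
    · rw [Pi.single_apply]
      split_ifs <;> simp
    · refine Pi.single_eq_of_ne ?_ _
      rintro rfl
      exact he he₀
    · rw [sum_eq_single_of_mem e₀ he₀ fun e _ he => Pi.single_eq_of_ne he _, Pi.single_eq_same]
    · rw [h, zero_mul]
      exact (sum_eq_zero_iff_of_nonneg fun e _ => hz e).1 h e he
  · refine ⟨fun e => if e ∈ G then z e / ∑ e ∈ G, z e else 0, fun e => ?_, fun e he => if_neg he,
      ?_, fun e he => ?_⟩
    · simp only
      split_ifs
      · exact div_nonneg (hz e) hs
      · exact le_rfl
    · rw [sum_ite_mem, inter_self, ← sum_div, div_self h]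
    · simp only [if_pos he]
      field_simp

theorem polytopeUpTo_append {l : List P.UDec} {v : P.UDec} (hv : v ∉ l)
    (hl : ∀ u ∈ l, P.decDepth u ≤ P.decDepth v) :
    polytopeUpTo (l ++ [v]) = scaledExtension (polytopeUpTo l) (arrival v) (choiceCoords v) := by
  have harr : ∀ u ∈ l ++ [v], ∀ y z : P.Coord → ℝ, (∀ e ∉ choiceCoords v, y e = z e) →
      arrival u y = arrival u z := by
    intro u hu y z h
    refine arrival_congr fun e he => h e (he.notMem_choiceCoords ?_)
    rcases List.mem_append.1 hu with hu | hu
    · exact hl u hu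
    · rw [List.mem_singleton.1 hu]
  have hsum : ∀ u ∈ l, ∀ y z : P.Coord → ℝ, (∀ e ∉ choiceCoords v, y e = z e) →
      ∑ i, y (choiceCoord u i) = ∑ i, z (choiceCoord u i) := fun u hu y z h =>
    Fintype.sum_congr _ _ fun i => h _ (choiceCoord_notMem (by rintro rfl; exact hv hu) i)
  have hvl : v ∈ l ++ [v] := by simp
  ext z
  constructor
  · rintro ⟨h1, h2, h3, h4, h5⟩
    obtain ⟨w, hw1, hw2, hw3, hw4⟩ := exists_simplex_scaling (choiceCoords_nonempty v) h4
    -- Erasing the last block recovers the base point, and the constraint at `v` says that the total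
    -- of the block is the scaling.
    set y : P.Coord → ℝ := fun e => if e ∈ choiceCoords v then 0 else z e with hy
    have hyz : ∀ e ∉ choiceCoords v, y e = z e := fun e he => if_neg he
    have hyG : ∀ e ∈ choiceCoords v, y e = 0 := fun e he => if_pos he
    refine ⟨y, ⟨fun u hu => ?_, ?_, fun τ hτ => ?_, fun e => ?_, fun e he => ?_⟩, w, hw1, hw2, hw3,
      ?_⟩
    · have hu' : u ∈ l ++ [v] := List.mem_append_left _ hu
      rw [harr u hu' y z hyz, hsum u hu y z hyz, h1 u hu']
    · rw [hyz _ (root_notMem_choiceCoords v _), h2]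
    · rw [hyz _ (root_notMem_choiceCoords v _), h3 τ hτ]
    · simp only [hy]
      split_ifs
      · exact le_rfl
      · exact h4 e
    · by_cases hG : e ∈ choiceCoords v
      · exact hyG e hG
      · rw [hyz e hG]
        refine h5 e ?_
        rw [coordsUpTo_append, mem_union]
        exact fun h => h.elim he hG
    · funext e
      rw [Pi.add_apply, Pi.smul_apply, smul_eq_mul, harr v hvl y z hyz, h1 v hvl,
        ← sum_choiceCoords]
      by_cases hG : e ∈ choiceCoords v
      · rw [hyG e hG, zero_add]
        exact hw4 e hG
      · rw [hyz e hG, hw2 e hG, mul_zero, add_zero]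
  · rintro ⟨y, ⟨h1, h2, h3, h4, h5⟩, w, hw1, hw2, hw3, rfl⟩
    set z : P.Coord → ℝ := y + arrival v y • w with hz
    have hyz : ∀ e ∉ choiceCoords v, z e = y e := fun e he => by simp [hz, hw2 e he]
    have hG : ∀ e ∈ choiceCoords v, z e = arrival v y * w e := fun e he => by
      have := h5 e (Finset.disjoint_right.1 (disjoint_coordsUpTo hv) he)
      simp [hz, this]
    refine ⟨fun u hu => ?_, ?_, fun τ hτ => ?_, fun e => ?_, fun e he => ?_⟩
    · rw [harr u hu z y hyz]
      rcases List.mem_append.1 hu with hu | hu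
      · rw [hsum u hu z y hyz, h1 u hu]
      · obtain rfl := List.mem_singleton.1 hu
        rw [← sum_choiceCoords, sum_congr rfl hG, ← mul_sum, hw3, mul_one]
    · rw [hyz _ (root_notMem_choiceCoords v _), h2]
    · rw [hyz _ (root_notMem_choiceCoords v _), h3 τ hτ]
    · exact add_nonneg (h4 e) (mul_nonneg (arrival_nonneg fun e _ => h4 e) (hw1 e))
    · rw [coordsUpTo_append, mem_union, not_or] at he
      rw [hyz e he.2, h5 e he.1]

theorem scaledExtensionChain_polytopeUpTo {l : List P.UDec} (hnd : l.Nodup)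
    (hl : l.Pairwise fun u v => P.decDepth u ≤ P.decDepth v) :
    ScaledExtensionChain P.rootPoint P.rootCoords
      (l.map fun v => (univ.image (choiceCoord v), arrival v)) (coordsUpTo l) (polytopeUpTo l) := by
  induction l using List.reverseRecOn with
  | nil =>
    rw [polytopeUpTo_nil]
    have : coordsUpTo (P := P) [] = P.rootCoords := by simp [coordsUpTo]
    rw [this]
    refine .point fun e he => ?_
    rw [rootPoint, Pi.single_eq_of_ne]
    rintro rfl
    exact he (mem_rootCoords.2 ⟨_, rfl⟩)
  | append_singleton l v ih =>
    rw [List.nodup_append] at hnd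
    rw [List.pairwise_append] at hl
    have hv : v ∉ l := fun h => hnd.2.2 v h v (by simp) rfl
    rw [List.map_append, List.map_singleton, coordsUpTo_append,
      polytopeUpTo_append hv fun u hu => hl.2.2 u hu v (by simp)]
    exact .extend _ _ _ _ _ (ih hnd.1 hl.1) (choiceCoords_nonempty v) (disjoint_coordsUpTo hv)
      (isLinearMap_arrival v) fun y hy => arrival_nonneg fun e _ => hy.2.2.2.1 e

theorem coordsUpTo_eq_univ {l : List P.UDec} (hl : ∀ v, v ∈ l) : coordsUpTo l = univ := by
  refine eq_univ_of_forall fun e => ?_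
  obtain ⟨τ, rfl⟩ | ⟨v, i, rfl⟩ := eq_root_or_exists_choiceCoord e
  · exact mem_union_left _ (mem_rootCoords.2 ⟨_, rfl⟩)
  · exact mem_union_right _
      (mem_biUnion.2 ⟨v, List.mem_toFinset.2 (hl v), mem_choiceCoords.2 ⟨i, rfl⟩⟩)

end Chain

end TreeFormDecisionProblem

/-- The elements of a finite type, ordered by a given rank. -/
theorem exists_list_sorted {ι α : Type*} [Fintype ι] [LinearOrder α] (rank : ι → α) :
    ∃ l : List ι, l.Nodup ∧ (∀ i, i ∈ l) ∧ l.Pairwise (fun i j => rank i ≤ rank j) ∧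
      l.Perm univ.toList := by
  let r : ι → ι → Prop := fun i j => rank i ≤ rank j
  have : Std.Total r := ⟨fun i j => le_total (rank i) (rank j)⟩
  have : IsTrans ι r := ⟨fun _ _ _ => le_trans⟩
  have hp := List.perm_insertionSort r (univ : Finset ι).toList
  exact ⟨_, hp.nodup_iff.2 (nodup_toList _), fun i => hp.mem_iff.2 (by simp),
    List.pairwise_insertionSort r _, hp⟩

namespace TreeFormDecisionProblem

theorem exists_scaledExtensionChain (P : TreeFormDecisionProblem.{u}) :
    ∃ order : List P.UDec, order.Nodup ∧ (∀ v, v ∈ order) ∧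
      ScaledExtensionChain P.rootPoint P.rootCoords
        (order.map fun v => (univ.image (choiceCoord v), arrival v)) univ P.utcPolytope := by
  obtain ⟨l, hnd, hmem, hl, -⟩ := exists_list_sorted P.decDepth
  refine ⟨l, hnd, hmem, ?_⟩
  have h := scaledExtensionChain_polytopeUpTo hnd hl
  rw [coordsUpTo_eq_univ hmem] at h
  convert h using 1
  ext z
  simp [utcPolytope, polytopeUpTo, coordsUpTo_eq_univ hmem, hmem]

end TreeFormDecisionProblem

namespace TreeFormDecisionProblem

/-! ### The regret decomposition of CFR. -/

section Regret

variable {P : TreeFormDecisionProblem.{u}}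

theorem convex_utcPolytope : Convex ℝ P.utcPolytope := by
  intro z hz z' hz' a b ha hb hab
  refine ⟨fun v => ?_, ?_, fun τ hτ => ?_, fun e => ?_⟩
  · rw [(isLinearMap_arrival v).map_add, (isLinearMap_arrival v).map_smul,
      (isLinearMap_arrival v).map_smul, hz.1, hz'.1]
    simp only [Pi.add_apply, Pi.smul_apply, smul_eq_mul, sum_add_distrib, mul_sum]
  · simp [hz.2.1, hz'.2.1, hab]
  · simp [hz.2.2.1 τ hτ, hz'.2.2.1 τ hτ]
  · have := hz.2.2.2 e
    have := hz'.2.2.2 e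
    simp only [Pi.add_apply, Pi.smul_apply, smul_eq_mul]
    positivity

/-- UTC deviations are given by points of the UTC polytope. -/
theorem exists_mem_utcPolytope_of_utc {φ : P.Deviation} (hφ : φ ∈ P.utcDeviations) :
    ∃ z ∈ P.utcPolytope, ∀ x : P.X, φ x = (devMatrix z).mulVec x := by
  obtain ⟨μ, hμ, rfl⟩ := hφ
  choose Z hZ using fun s : P.PureDeviator => exists_generates (pointStrategy s)
  refine ⟨∑ s, μ s • Z s, convex_utcPolytope.sum_mem (fun s _ => hμ.1 s) hμ.2 fun s _ =>
    (hZ s).mem_utcPolytope (pointStrategy_mem s), fun x => ?_⟩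
  rw [Finset.sum_apply]
  simp only [Pi.smul_apply, (hZ _).pureDeviation_eq]
  funext σ
  simp only [Matrix.mulVec, dotProduct, devMatrix, Matrix.of_apply, Finset.sum_apply,
    Pi.smul_apply, smul_eq_mul, sum_mul, mul_sum]
  rw [sum_comm]
  simp only [mul_assoc]

/-- Induction over the decision points of the UTC problem, from the leaves upwards. -/
theorem uDec_induction {p : P.UDec → Prop}
    (step : ∀ j τ, (∀ a, ∀ k : P.Next (P.child j a), p (k.1, τ)) →
      (∀ k : P.Next τ, ∀ a, p (j, P.child k.1 a)) → p (j, τ)) (v : P.UDec) : p v := by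
  obtain ⟨N, hN⟩ : ∃ N, ∀ v, P.decDepth v ≤ N :=
    ⟨univ.sup P.decDepth, fun v => le_sup (f := P.decDepth) (mem_univ v)⟩
  induction h : N - P.decDepth v using Nat.strong_induction_on generalizing v with
  | _ n ih =>
    obtain ⟨j, τ⟩ := v
    refine step j τ (fun a k => ih _ ?_ _ rfl) fun k a => ih _ ?_ _ rfl
    · have h1 := depth_of_parent k.2
      have h2 := hN (k.1, τ)
      simp only [decDepth] at *
      omega
    · have h1 := P.seqDepth_parent k.1
      have h2 := hN (j, P.child k.1 a)
      rw [k.2] at h1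
      simp only [decDepth, seqDepth_child] at *
      omega

/-- The best future utilities at the decision points. -/
theorem exists_value_bound {w : P.Seq → ℝ} (hw : P.IsUtility w) :
    ∃ W : P.Dec → ℝ, (∀ j, 0 ≤ W j) ∧ (∀ j, W j ≤ 1) ∧
      ∀ j a, w (P.child j a) + ∑ k : P.Next (P.child j a), W k.1 ≤ W j := by
  -- Normalizing `-w` turns the Bellman minimum into a maximum: `-b` is the best future utility.
  obtain ⟨b, hb⟩ := exists_isNormal_gauge (-w)
  have hstep : ∀ j a, w (P.child j a) + ∑ k : P.Next (P.child j a), (-b) k.1 ≤ (-b) j := by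
    intro j a
    have := (hb j).1 a
    simp only [Pi.add_apply, Pi.neg_apply, gauge_child] at this
    simp only [Pi.neg_apply, sum_neg_distrib]
    linarith
  have hnn : ∀ j, 0 ≤ (-b) j := by
    intro j
    induction j using dec_induction with
    | step j ih =>
      have a := Classical.arbitrary (P.Act j)
      refine le_trans ?_ (hstep j a)
      exact add_nonneg (hw.1 _).1 (sum_nonneg fun k _ => ih a k)
  -- The left side is the value of an optimal pure strategy, hence at most one. Nonnegativity of `w`
  -- and of the values passes the bound down the tree.
  have hroot : w P.root + ∑ k : P.Next P.root, (-b) k.1 ≤ 1 := by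
    obtain ⟨x, hx, h⟩ := exists_dotProduct_eq_of_isNormal hb
    rw [add_gauge_dotProduct (isFlow_of_mem_X hx), neg_dotProduct] at h
    have h1 := (hw.2 x hx).2
    simp only [Pi.add_apply, Pi.neg_apply, gauge_root] at h
    simp only [Pi.neg_apply, sum_neg_distrib]
    linarith
  have hle : ∀ j, w (P.parent j) + ∑ k : P.Next (P.parent j), (-b) k.1 ≤ 1 → (-b) j ≤ 1 := by
    intro j h
    have h1 := (hw.1 (P.parent j)).1
    have h2 := single_le_sum (f := fun k : P.Next (P.parent j) => (-b) k.1)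
      (fun k _ => hnn k.1) (mem_univ ⟨j, rfl⟩)
    linarith
  have hall : ∀ σ, w σ + ∑ k : P.Next σ, (-b) k.1 ≤ 1 := by
    intro σ
    induction σ using seq_induction with
    | root => exact hroot
    | step j ih a => exact (hstep j a).trans (hle j ih)
  exact ⟨-b, hnn, fun j => hle j (hall _), hstep⟩

variable {R : ∀ v : P.UDec, LocalMinimizer (P.Choice v)} {w : ℕ → P.Seq → ℝ}

theorem CFRRun.strat_mem (run : P.CFRRun R w) (t : ℕ) (v : P.UDec) :
    run.strat t v ∈ stdSimplex ℝ (P.Choice v) := by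
  rw [run.strat_eq]
  exact (R v).next_mem _

theorem CFRRun.generates (run : P.CFRRun R w) (t : ℕ) : Generates (run.strat t) (run.dev t) :=
  ⟨run.dev_root t, run.dev_root_of_ne t, run.dev_choice t⟩

theorem CFRRun.dev_mem (run : P.CFRRun R w) (t : ℕ) : run.dev t ∈ P.utcPolytope :=
  (run.generates t).mem_utcPolytope (run.strat_mem t)

/-- The counterfactual utilities of CFR lie in `[0,1]`. -/
theorem CFRRun.gain_mem_Icc (run : P.CFRRun R w) (hw : ∀ t, P.IsUtility (w t)) (t : ℕ)
    (v : P.UDec) (i : P.Choice v) : run.gain t v i ∈ Set.Icc (0 : ℝ) 1 := by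
  obtain ⟨W, hW0, hW1, hW⟩ := exists_value_bound (hw t)
  have hx := isFlow_of_mem_coX (run.x_mem t)
  -- Counterfactual utilities at `(j, τ)` carry the factor `x(τ)`. A query only splits this factor
  -- over the replies, so the bound does not grow.
  have key : ∀ v, ((∀ i, run.gain t v i ∈ Set.Icc 0 (run.x t v.2 * W v.1)) ∧
      run.value t v ∈ Set.Icc 0 (run.x t v.2 * W v.1)) := by
    intro v
    induction v using uDec_induction with
    | step j τ ih1 ih2 =>
      have hg : ∀ i, run.gain t (j, τ) i ∈ Set.Icc 0 (run.x t τ * W j) := by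
        rintro (a | k)
        · rw [run.gain_play]
          constructor
          · exact add_nonneg (mul_nonneg ((hw t).1 _).1 (hx.nonneg τ))
              (sum_nonneg fun k _ => (ih1 a k).2.1)
          · calc _ ≤ w t (P.child j a) * run.x t τ +
                  ∑ k : P.Next (P.child j a), run.x t τ * W k.1 :=
                  add_le_add le_rfl (sum_le_sum fun k _ => (ih1 a k).2.2)
              _ = run.x t τ * (w t (P.child j a) + ∑ k : P.Next (P.child j a), W k.1) := by
                  rw [← mul_sum]; ring
              _ ≤ _ := mul_le_mul_of_nonneg_left (hW j a) (hx.nonneg τ)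
        · rw [run.gain_query]
          constructor
          · exact sum_nonneg fun a _ => (ih2 k a).2.1
          · calc _ ≤ ∑ a, run.x t (P.child k.1 a) * W j := sum_le_sum fun a _ => (ih2 k a).2.2
              _ = _ := by
                rw [← sum_mul, hx.sum_child]
                exact congrArg (fun σ => run.x t σ * W j) k.2
      refine ⟨hg, ?_⟩
      have hs := run.strat_mem t (j, τ)
      rw [run.value_eq]
      refine ⟨sum_nonneg fun i _ => mul_nonneg (hs.1 i) (hg i).1, ?_⟩
      calc _ ≤ ∑ i, run.strat t (j, τ) i * (run.x t τ * W j) :=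
            sum_le_sum fun i _ => mul_le_mul_of_nonneg_left (hg i).2 (hs.1 i)
        _ = _ := by rw [← sum_mul, hs.2, one_mul]
  have h := (key v).1 i
  exact ⟨h.1, h.2.trans (mul_le_one₀ (hx.le_one _) (hW0 _) (hW1 _))⟩

/-- The advantages over the counterfactual values, weighted by the masses of a point `z` of the
polytope, add up to the utility of `z` minus a constant. -/
theorem CFRRun.sum_advantage (run : P.CFRRun R w) (t : ℕ) {z : P.Coord → ℝ}
    (hz : z ∈ P.utcPolytope) :
    ∑ v : P.UDec, (∑ i, z (choiceCoord v i) * run.gain t v i - arrival v z * run.value t v) =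
      w t ⬝ᵥ (devMatrix z).mulVec (run.x t) -
        (w t P.root + ∑ k : P.Next P.root, run.value t (k.1, P.root)) := by
  have hx := isFlow_of_mem_coX (run.x_mem t)
  set V := run.value t
  -- The immediate utilities give the total utility of `z`, except at the root, where every flow has
  -- value one.
  have hA : ∑ j, ∑ τ, ∑ a, z (.inl (P.child j a, τ)) * (w t (P.child j a) * run.x t τ) =
      w t ⬝ᵥ (devMatrix z).mulVec (run.x t) - w t P.root := by
    have h1 := (isFlow_mulVec hz hx).root
    rw [dotProduct, sum_seq, h1, mul_one, add_sub_cancel_left]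
    refine Fintype.sum_congr _ _ fun j => ?_
    rw [sum_comm]
    refine Fintype.sum_congr _ _ fun a => ?_
    rw [Matrix.mulVec, dotProduct, mul_sum]
    refine Fintype.sum_congr _ _ fun τ => ?_
    simp only [devMatrix, Matrix.of_apply]
    ring
  -- Continuation values after actions cancel the part of the arrivals that comes from observations.
  -- Only the decision points directly below the root are left over.
  have hB : ∑ j, ∑ τ, ∑ a, z (.inl (P.child j a, τ)) *
      ∑ k : P.Next (P.child j a), V (k.1, τ) =
      ∑ j, ∑ τ, z (.inl (P.parent j, τ)) * V (j, τ) -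
        ∑ k : P.Next P.root, V (k.1, P.root) := by
    have h1 : ∀ τ, ∑ k, z (.inl (P.parent k, τ)) * V (k, τ) =
        z (.inl (P.root, τ)) * ∑ k : P.Next P.root, V (k.1, τ) +
        ∑ j, ∑ a, z (.inl (P.child j a, τ)) * ∑ k : P.Next (P.child j a), V (k.1, τ) := by
      intro τ
      rw [← sum_next fun σ k => z (.inl (σ, τ)) * V (k, τ)]
      simp only [← mul_sum]
      rw [sum_seq fun σ => z (.inl (σ, τ)) * ∑ k : P.Next σ, V (k.1, τ)]
    rw [sum_comm, sum_comm (f := fun j τ => z (.inl (P.parent j, τ)) * V (j, τ)),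
      Fintype.sum_congr _ _ h1, sum_add_distrib, add_sub_right_comm]
    simp only [root_eq_single hz, Pi.single_apply, ite_mul, one_mul, zero_mul, sum_ite_eq',
      mem_univ, if_true, sub_self, zero_add]
  -- Continuation values after queries cancel the part that comes from replies, on grouping the
  -- states `τ = ka` by `k`.
  have hC : ∑ j, ∑ τ, ∑ k : P.Next τ, z (.inr (j, k.1)) * ∑ a, V (j, P.child k.1 a) =
      ∑ j, ∑ τ, before (fun k => z (.inr (j, k))) τ * V (j, τ) := by
    refine Fintype.sum_congr _ _ fun j => ?_
    rw [sum_next fun _ k => z (.inr (j, k)) * ∑ a, V (j, P.child k a), sum_seq]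
    simp only [before_root, zero_mul, zero_add, before_child, mul_sum]
  simp only [Fintype.sum_prod_type, Fintype.sum_sum_type, choiceCoord, run.gain_play,
    run.gain_query, arrival, queryMass_eq_before, sum_sub_distrib, sum_add_distrib, mul_add,
    add_mul, hA]
  rw [hB, hC]
  ring

/-- The constant in `CFRRun.sum_advantage` cancels between `z` and the iterate, whose advantages
vanish because values are averages of gains under its own local strategies. -/
theorem CFRRun.utility_sub (run : P.CFRRun R w) (t : ℕ) {z : P.Coord → ℝ}
    (hz : z ∈ P.utcPolytope) :
    w t ⬝ᵥ ((devMatrix z).mulVec (run.x t) - run.x t) =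
      ∑ v : P.UDec, (∑ i, z (choiceCoord v i) * run.gain t v i - arrival v z * run.value t v) := by
  have h := run.sum_advantage t (run.dev_mem t)
  rw [run.x_fixed, sum_eq_zero fun v _ => ?_] at h
  · rw [run.sum_advantage t hz, dotProduct_sub]
    linarith
  · rw [run.value_eq, mul_sum, ← sum_sub_distrib]
    refine sum_eq_zero fun i _ => ?_
    rw [run.dev_choice]
    ring

/-- Normalizing the choices of `z` at `v` gives a fixed comparator for `R v`. The remaining factor,
the arrival, may be dropped since it is at most one and `ρ` is nonnegative. -/
theorem CFRRun.sum_advantage_le (run : P.CFRRun R w) (hw : ∀ t, P.IsUtility (w t))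
    {z : P.Coord → ℝ} (hz : z ∈ P.utcPolytope) {v : P.UDec} {ρ : ℕ → ℝ}
    (hρ : (R v).HasRegret ρ) (T : ℕ) :
    ∑ t ∈ range T, (∑ i, z (choiceCoord v i) * run.gain t v i - arrival v z * run.value t v) ≤
      ρ T := by
  obtain ⟨y, hy0, -, hy1, hy⟩ := exists_simplex_scaling (univ_nonempty (α := P.Choice v))
    (z := fun i => z (choiceCoord v i)) fun i => hz.2.2.2 _
  rw [← hz.1 v] at hy
  have hterm : ∀ t, ∑ i, z (choiceCoord v i) * run.gain t v i - arrival v z * run.value t v =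
      arrival v z * (run.gain t v ⬝ᵥ (y - (R v).next (history (fun s => run.gain s v) t))) := by
    intro t
    rw [← run.strat_eq, dotProduct_sub, mul_sub, dotProduct_comm _ (run.strat t v), run.value_eq]
    congr 1
    rw [dotProduct, mul_sum]
    refine Fintype.sum_congr _ _ fun i => ?_
    rw [hy i (mem_univ i)]
    ring
  simp only [hterm, ← mul_sum]
  have harr : 0 ≤ arrival v z := arrival_nonneg fun e _ => hz.2.2.2 e
  calc _ ≤ arrival v z * ρ T :=
        mul_le_mul_of_nonneg_left
          (hρ (fun s => run.gain s v) (fun t i => run.gain_mem_Icc hw t v i) T y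
            ⟨hy0, hy1⟩) harr
    _ ≤ ρ T := mul_le_of_le_one_left (hρ.nonneg T) (arrival_le_one hz v)

/-- For a linear deviation only the mean of the played distribution matters. -/
theorem regretAgainst_eq {π : ℕ → P.X → ℝ} {φ : P.Deviation} {z : P.Coord → ℝ}
    (hφ : ∀ x : P.X, φ x = (devMatrix z).mulVec x) (T : ℕ) :
    regretAgainst π w T φ =
      ∑ t ∈ range T, w t ⬝ᵥ ((devMatrix z).mulVec (mean (π t)) - mean (π t)) := by
  refine sum_congr rfl fun t _ => ?_
  simp only [mean, Matrix.mulVec_sum, Matrix.mulVec_smul, hφ, ← sum_sub_distrib, ← smul_sub,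
    dotProduct_sum, dotProduct_smul, smul_eq_mul]

theorem CFRRun.regret_le (run : P.CFRRun R w) (hw : ∀ t, P.IsUtility (w t))
    {ρ : P.UDec → ℕ → ℝ} (hρ : ∀ v, (R v).HasRegret (ρ v)) {π : ℕ → P.X → ℝ}
    (hπ : ∀ t, mean (π t) = run.x t) (T : ℕ) {φ : P.Deviation}
    (hφ : ∃ z ∈ P.utcPolytope, ∀ x : P.X, φ x = (devMatrix z).mulVec x) :
    regretAgainst π w T φ ≤ ∑ v, ρ v T := by
  obtain ⟨z, hz, hφ⟩ := hφ
  rw [regretAgainst_eq hφ]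
  simp only [hπ, run.utility_sub _ hz]
  rw [sum_comm]
  exact sum_le_sum fun v _ => run.sum_advantage_le hw hz (hρ v) T

theorem CFRRun.correctness (run : P.CFRRun R w) (hw : ∀ t, P.IsUtility (w t)) :
    (∀ t, run.dev t ∈ P.utcPolytope ∧
      Set.MapsTo (devMatrix (run.dev t)).mulVec P.coX P.coX ∧
      (fun x : P.X => (devMatrix (run.dev t)).mulVec x) ∈ P.utcDeviations) ∧
    ∀ ρ : P.UDec → ℕ → ℝ, (∀ v, (R v).HasRegret (ρ v)) →
    ∀ π : ℕ → P.X → ℝ, (∀ t, π t ∈ stdSimplex ℝ P.X) → (∀ t, mean (π t) = run.x t) →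
    ∀ T : ℕ,
      (PhiRegretLE P.utcDeviations π w T (∑ v, ρ v T) ∧
        PhiRegretLE P.linearDeviations π w T (∑ v, ρ v T)) ∧
      ∀ C : ℝ, 0 ≤ C → (∀ v, ρ v T ≤ C * Fintype.card (P.Choice v) * Real.sqrt T) →
        PhiRegretLE P.utcDeviations π w T (2 * C * (P.size : ℝ) ^ 2 * Real.sqrt T) ∧
        PhiRegretLE P.linearDeviations π w T (2 * C * (P.size : ℝ) ^ 2 * Real.sqrt T) := by
  refine ⟨fun t => ⟨run.dev_mem t, (run.generates t).mapsTo_coX (run.strat_mem t),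
    (run.generates t).mem_utcDeviations (run.strat_mem t)⟩, fun ρ hρ π _ hπ T => ?_⟩
  have hutc : PhiRegretLE P.utcDeviations π w T (∑ v, ρ v T) := fun φ hφ =>
    run.regret_le hw hρ hπ T (exists_mem_utcPolytope_of_utc hφ)
  have hlin : PhiRegretLE P.linearDeviations π w T (∑ v, ρ v T) := fun φ hφ =>
    run.regret_le hw hρ hπ T (exists_mem_utcPolytope_of_linear hφ)
  refine ⟨⟨hutc, hlin⟩, fun C hC hle => ?_⟩
  have hsum : ∑ v, ρ v T ≤ 2 * C * (P.size : ℝ) ^ 2 * Real.sqrt T := by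
    have h1 : (∑ v : P.UDec, (Fintype.card (P.Choice v) : ℝ)) ≤ 2 * (P.size : ℝ) ^ 2 := by
      exact_mod_cast sum_card_choice_le (P := P)
    calc _ ≤ ∑ v : P.UDec, C * Fintype.card (P.Choice v) * Real.sqrt T :=
          sum_le_sum fun v _ => hle v
      _ = C * (∑ v : P.UDec, (Fintype.card (P.Choice v) : ℝ)) * Real.sqrt T := by
          rw [← sum_mul, ← mul_sum]
      _ ≤ C * (2 * (P.size : ℝ) ^ 2) * Real.sqrt T := by gcongr
      _ = _ := by ring
  exact ⟨fun φ hφ => (hutc φ hφ).trans hsum, fun φ hφ => (hlin φ hφ).trans hsum⟩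

end Regret

end TreeFormDecisionProblem

namespace TreeFormDecisionProblem

/-! ### Straight-line programs -/

section Machine

variable {P : TreeFormDecisionProblem.{u}} {R : ∀ v : P.UDec, LocalMinimizer (P.Choice v)}
  {fixpt : Matrix P.Seq P.Seq ℝ → P.Seq → ℝ}

theorem runProg_append (p q : List P.Instr) (s : P.MachineState) :
    runProg R fixpt (p ++ q) s = runProg R fixpt q (runProg R fixpt p s) :=
  List.foldl_append

theorem runProg_cons (i : P.Instr) (p : List P.Instr) (s : P.MachineState) :
    runProg R fixpt (i :: p) s = runProg R fixpt p (i.exec R fixpt s) := rfl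

theorem progCost_append (f : ℕ) (ca ct : P.UDec → ℕ) (p q : List P.Instr) :
    progCost f ca ct (p ++ q) = progCost f ca ct p + progCost f ca ct q := by
  simp [progCost]

theorem progCost_cons (f : ℕ) (ca ct : P.UDec → ℕ) (i : P.Instr) (p : List P.Instr) :
    progCost f ca ct (i :: p) = i.cost f ca ct + progCost f ca ct p := by
  simp [progCost]

@[simp] theorem store_mem_self (s : P.MachineState) (r : P.Register) (c : ℝ) :
    (s.store r c).mem r = c := by
  simp [MachineState.store]

theorem store_mem_of_ne (s : P.MachineState) {r r' : P.Register} (h : r' ≠ r) (c : ℝ) :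
    (s.store r c).mem r' = s.mem r' := by
  simp [MachineState.store, h]

/-- Add the products of the given pairs of registers to `dst`. -/
def addProducts (dst : P.Register) (args : List (P.Register × P.Register)) : List P.Instr :=
  args.flatMap fun p => [.mul (.work 0) p.1 p.2, .add dst dst (.work 0)]

theorem runProg_addProducts {dst : P.Register} (hd : dst ≠ .work 0)
    {args : List (P.Register × P.Register)}
    (ha : ∀ p ∈ args, p.1 ≠ .work 0 ∧ p.2 ≠ .work 0 ∧ p.1 ≠ dst ∧ p.2 ≠ dst)
    (s : P.MachineState) :
    (runProg R fixpt (addProducts dst args) s).hist = s.hist ∧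
    (runProg R fixpt (addProducts dst args) s).mem dst =
      s.mem dst + (args.map fun p => s.mem p.1 * s.mem p.2).sum ∧
    ∀ r, r ≠ dst → r ≠ .work 0 → (runProg R fixpt (addProducts dst args) s).mem r = s.mem r := by
  induction args generalizing s with
  | nil => exact ⟨rfl, by simp [addProducts, runProg], fun _ _ _ => rfl⟩
  | cons p args ih =>
    set s₁ := (s.store (.work 0) (s.mem p.1 * s.mem p.2)) with hs₁
    set s₂ := s₁.store dst (s₁.mem dst + s₁.mem (.work 0)) with hs₂
    have hrun : runProg R fixpt (addProducts dst (p :: args)) s =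
        runProg R fixpt (addProducts dst args) s₂ := rfl
    have hother : ∀ r, r ≠ dst → r ≠ .work 0 → s₂.mem r = s.mem r := fun r h1 h2 => by
      rw [hs₂, store_mem_of_ne _ h1, hs₁, store_mem_of_ne _ h2]
    obtain ⟨h1, h2, h3⟩ := ih (fun p hp => ha p (List.mem_cons_of_mem _ hp)) s₂
    rw [hrun]
    refine ⟨h1, ?_, fun r hr1 hr2 => (h3 r hr1 hr2).trans (hother r hr1 hr2)⟩
    have hmap : (args.map fun p => s₂.mem p.1 * s₂.mem p.2) =
        args.map fun p => s.mem p.1 * s.mem p.2 := by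
      refine List.map_congr_left fun q hq => ?_
      obtain ⟨a1, a2, a3, a4⟩ := ha q (List.mem_cons_of_mem _ hq)
      rw [hother _ a3 a1, hother _ a4 a2]
    rw [h2, hmap, List.map_cons, List.sum_cons, hs₂, store_mem_self, hs₁, store_mem_self,
      store_mem_of_ne _ hd, add_assoc]

/-- Compute a sum of products in `dst`. -/
def assign (dst : P.Register) (args : List (P.Register × P.Register)) : List P.Instr :=
  .const dst 0 :: addProducts dst args

theorem runProg_assign {dst : P.Register} (hd : dst ≠ .work 0)
    {args : List (P.Register × P.Register)}
    (ha : ∀ p ∈ args, p.1 ≠ .work 0 ∧ p.2 ≠ .work 0 ∧ p.1 ≠ dst ∧ p.2 ≠ dst)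
    (s : P.MachineState) :
    (runProg R fixpt (assign dst args) s).hist = s.hist ∧
    (runProg R fixpt (assign dst args) s).mem dst =
      (args.map fun p => s.mem p.1 * s.mem p.2).sum ∧
    ∀ r, r ≠ dst → r ≠ .work 0 → (runProg R fixpt (assign dst args) s).mem r = s.mem r := by
  obtain ⟨h1, h2, h3⟩ := runProg_addProducts (R := R) (fixpt := fixpt) hd ha (s.store dst (0 : ℕ))
  refine ⟨h1, ?_, fun r hr1 hr2 => (h3 r hr1 hr2).trans (store_mem_of_ne _ hr1 _)⟩
  refine h2.trans ?_
  rw [store_mem_self, Nat.cast_zero, zero_add]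
  congr 1
  refine List.map_congr_left fun q hq => ?_
  obtain ⟨-, -, a3, a4⟩ := ha q hq
  rw [store_mem_of_ne _ a3, store_mem_of_ne _ a4]

theorem progCost_assign (f : ℕ) (ca ct : P.UDec → ℕ) (dst : P.Register)
    (args : List (P.Register × P.Register)) :
    progCost f ca ct (assign dst args) = 1 + 2 * args.length := by
  rw [assign, progCost_cons]
  congr 1
  induction args with
  | nil => rfl
  | cons p args ih =>
    have : addProducts dst (p :: args) =
        .mul (.work 0) p.1 p.2 :: .add dst dst (.work 0) :: addProducts dst args := rfl
    rw [this, progCost_cons, progCost_cons, ih, List.length_cons]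
    simp only [Instr.cost]
    omega

/-- A system of assignments `dst i := ∑ a * b` over the pairs of registers `(a, b)` in `args i`,
in which every assignment only uses results of lower rank. -/
structure Schedule (P : TreeFormDecisionProblem.{u}) (ι : Type*) where
  dst : ι → P.Register
  args : ι → List (P.Register × P.Register)
  rank : ι → ℤ
  dst_injective : Function.Injective dst
  dst_ne_scratch : ∀ i, dst i ≠ .work 0
  dst_ne_one : ∀ i, dst i ≠ .work 1
  args_ne_scratch : ∀ i, ∀ p ∈ args i, p.1 ≠ .work 0 ∧ p.2 ≠ .work 0
  rank_lt : ∀ i, ∀ p ∈ args i, ∀ i', p.1 = dst i' ∨ p.2 = dst i' → rank i' < rank i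

namespace Schedule

variable {ι : Type*} (S : P.Schedule ι)

/-- Carry out the assignments in `l`. -/
def program (l : List ι) : List P.Instr := l.flatMap fun i => assign (S.dst i) (S.args i)

/-- In rank order no assignment overwrites an operand or result of an earlier one. The equations
therefore hold together in the final memory, and not only at the moment of each assignment. -/
theorem runProg_program {l : List ι} (hnd : l.Nodup)
    (hl : l.Pairwise fun i j => S.rank i ≤ S.rank j) (s : P.MachineState) :
    (runProg R fixpt (S.program l) s).hist = s.hist ∧
    (∀ i ∈ l, (runProg R fixpt (S.program l) s).mem (S.dst i) =
      ((S.args i).map fun p => (runProg R fixpt (S.program l) s).mem p.1 *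
        (runProg R fixpt (S.program l) s).mem p.2).sum) ∧
    ∀ r, (∀ i ∈ l, r ≠ S.dst i) → r ≠ .work 0 →
      (runProg R fixpt (S.program l) s).mem r = s.mem r := by
  induction l using List.reverseRecOn with
  | nil => exact ⟨rfl, by simp, fun _ _ _ => rfl⟩
  | append_singleton l j ih =>
    rw [List.nodup_append] at hnd
    rw [List.pairwise_append] at hl
    obtain ⟨h1, h2, h3⟩ := ih hnd.1 hl.1
    have hprog : S.program (l ++ [j]) = S.program l ++ assign (S.dst j) (S.args j) := by
      simp [program]
    rw [hprog, runProg_append]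
    set s₁ := runProg R fixpt (S.program l) s
    have hself : ∀ p ∈ S.args j, p.1 ≠ S.dst j ∧ p.2 ≠ S.dst j := fun p hp =>
      ⟨fun h => lt_irrefl _ (S.rank_lt j p hp j (.inl h)),
        fun h => lt_irrefl _ (S.rank_lt j p hp j (.inr h))⟩
    obtain ⟨k1, k2, k3⟩ := runProg_assign (R := R) (fixpt := fixpt) (S.dst_ne_scratch j)
      (fun p hp => ⟨(S.args_ne_scratch j p hp).1, (S.args_ne_scratch j p hp).2, hself p hp⟩) s₁
    set s₂ := runProg R fixpt (assign (S.dst j) (S.args j)) s₁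
    refine ⟨k1.trans h1, fun i hi => ?_, fun r hr hr0 => ?_⟩
    · rcases List.mem_append.1 hi with hi | hi
      · have hrank := hl.2.2 i hi j (by simp)
        have hne : S.dst i ≠ S.dst j := fun h =>
          hnd.2.2 i hi j (by simp) (S.dst_injective h)
        rw [k3 _ hne (S.dst_ne_scratch i), h2 i hi]
        congr 1
        refine List.map_congr_left fun p hp => ?_
        obtain ⟨a1, a2⟩ := S.args_ne_scratch i p hp
        rw [k3 p.1 (fun h => (S.rank_lt i p hp j (.inl h)).not_ge hrank) a1,
          k3 p.2 (fun h => (S.rank_lt i p hp j (.inr h)).not_ge hrank) a2]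
      · obtain rfl := List.mem_singleton.1 hi
        rw [k2]
        congr 1
        refine List.map_congr_left fun p hp => ?_
        obtain ⟨a1, a2⟩ := S.args_ne_scratch i p hp
        rw [k3 p.1 (hself p hp).1 a1, k3 p.2 (hself p hp).2 a2]
    · rw [k3 r (hr j (by simp)) hr0]
      exact h3 r (fun i hi => hr i (List.mem_append_left _ hi)) hr0

/-- Every finite system of assignments is carried out by a program that satisfies all equations at
its end; the register `work 1` holds the constant `1`. -/
theorem exists_program [Fintype ι] : ∃ p : List P.Instr,
    (∀ (R : ∀ v : P.UDec, LocalMinimizer (P.Choice v))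
      (fixpt : Matrix P.Seq P.Seq ℝ → P.Seq → ℝ) (s : P.MachineState),
      (runProg R fixpt p s).hist = s.hist ∧
      (runProg R fixpt p s).mem (.work 1) = 1 ∧
      (∀ i, (runProg R fixpt p s).mem (S.dst i) = ((S.args i).map fun p' =>
        (runProg R fixpt p s).mem p'.1 * (runProg R fixpt p s).mem p'.2).sum) ∧
      ∀ r, (∀ i, r ≠ S.dst i) → r ≠ .work 0 → r ≠ .work 1 →
        (runProg R fixpt p s).mem r = s.mem r) ∧
    ∀ (f : ℕ) (ca ct : P.UDec → ℕ),
      progCost f ca ct p = 1 + ∑ i, (1 + 2 * (S.args i).length) := by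
  obtain ⟨l, hnd, hmem, hl, hperm⟩ := exists_list_sorted S.rank
  refine ⟨.const (.work 1) 1 :: S.program l, fun R fixpt s => ?_, fun f ca ct => ?_⟩
  · rw [runProg_cons]
    obtain ⟨h1, h2, h3⟩ := S.runProg_program (R := R) (fixpt := fixpt) hnd hl
      (s.store (.work 1) (1 : ℕ))
    refine ⟨h1, ?_, fun i => h2 i (hmem i), fun r hr h0 h1 => ?_⟩
    · refine (h3 _ (fun i _ => (S.dst_ne_one i).symm) (by simp)).trans ?_
      rw [store_mem_self, Nat.cast_one]
    · exact (h3 r (fun i _ => hr i) h0).trans (store_mem_of_ne _ h1 _)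
  · rw [progCost_cons]
    congr 1
    rw [← sum_map_toList, ← (hperm.map _).sum_eq]
    clear hnd hmem hl hperm
    induction l with
    | nil => rfl
    | cons i l ih =>
      have : S.program (i :: l) = assign (S.dst i) (S.args i) ++ S.program l := rfl
      rw [this, progCost_append, progCost_assign, ih, List.map_cons, List.sum_cons]

end Schedule

/-! ### Calls of the local minimizers -/

theorem runProg_ask (l : List P.UDec) (s : P.MachineState) :
    (runProg R fixpt (l.map .ask) s).hist = s.hist ∧
    ∀ v ∈ l, ∀ i, (runProg R fixpt (l.map .ask) s).mem (.strat v i) =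
      (R v).next (s.hist v) i := by
  induction l using List.reverseRecOn with
  | nil => exact ⟨rfl, by simp⟩
  | append_singleton l u ih =>
    rw [List.map_append, runProg_append]
    refine ⟨ih.1, fun v hv i => ?_⟩
    change (if v = u then (R v).next ((runProg R fixpt (l.map .ask) s).hist v) i
      else (runProg R fixpt (l.map .ask) s).mem (.strat v i)) = _
    split_ifs with h
    · rw [ih.1]
    · refine ih.2 v ?_ i
      simpa [h] using hv

/-- Unlike `ask`, which leaves histories alone and may be repeated, `tell` appends; duplicates would
record a utility twice. -/
theorem runProg_tell {l : List P.UDec} (hnd : l.Nodup) (s : P.MachineState) :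
    (runProg R fixpt (l.map .tell) s).mem = s.mem ∧
    ∀ v, (runProg R fixpt (l.map .tell) s).hist v =
      if v ∈ l then s.hist v ++ [fun i => s.mem (.gain v i)] else s.hist v := by
  induction l generalizing s with
  | nil => exact ⟨rfl, by simp [runProg]⟩
  | cons u l ih =>
    rw [List.nodup_cons] at hnd
    rw [List.map_cons, runProg_cons]
    obtain ⟨h1, h2⟩ := ih hnd.2 (Instr.exec R fixpt s (.tell u))
    refine ⟨h1, fun v => (h2 v).trans ?_⟩
    simp only [Instr.exec, List.mem_cons]
    by_cases hv : v = u
    · simp [hv, hnd.1]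
    · simp [hv]

theorem progCost_ask (f : ℕ) (ca ct : P.UDec → ℕ) :
    progCost f ca ct ((univ : Finset P.UDec).toList.map .ask) =
      ∑ v : P.UDec, Fintype.card (P.Choice v) + ∑ v, ca v := by
  rw [progCost, List.map_map, ← sum_add_distrib, ← sum_map_toList]
  rfl

theorem progCost_tell (f : ℕ) (ca ct : P.UDec → ℕ) :
    progCost f ca ct ((univ : Finset P.UDec).toList.map .tell) =
      ∑ v : P.UDec, Fintype.card (P.Choice v) + ∑ v, ct v := by
  rw [progCost, List.map_map, ← sum_add_distrib, ← sum_map_toList]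
  rfl

/-! ### The two passes of an iteration -/

/-- The work register of an intermediate result: the entries of the matrix `B`, the masses that
arrive at the decision points, and the counterfactual values. -/
noncomputable def workReg (e : (P.Dec × P.Dec) ⊕ P.UDec ⊕ P.UDec) : P.Register :=
  -- The shift by two reserves `work 0` as scratch space and `work 1` for the constant one.
  .work (Fintype.equivFin _ e + 2)

theorem workReg_injective : Function.Injective (workReg (P := P)) := by
  intro e e' h
  simpa [workReg, Fin.val_inj] using h

@[simp] theorem workReg_inj {e e' : (P.Dec × P.Dec) ⊕ P.UDec ⊕ P.UDec} :
    workReg e = workReg e' ↔ e = e' := workReg_injective.eq_iff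

@[simp] theorem workReg_ne_zero (e : (P.Dec × P.Dec) ⊕ P.UDec ⊕ P.UDec) :
    workReg e ≠ .work 0 := by simp [workReg]

@[simp] theorem workReg_ne_one (e : (P.Dec × P.Dec) ⊕ P.UDec ⊕ P.UDec) :
    workReg e ≠ .work 1 := by simp [workReg]

@[simp] theorem workReg_ne_matrix (e : (P.Dec × P.Dec) ⊕ P.UDec ⊕ P.UDec) (σ τ : P.Seq) :
    workReg e ≠ .matrix σ τ := by simp [workReg]

@[simp] theorem workReg_ne_gain (e : (P.Dec × P.Dec) ⊕ P.UDec ⊕ P.UDec) (v : P.UDec)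
    (i : P.Choice v) : workReg e ≠ .gain v i := by simp [workReg]

@[simp] theorem workReg_ne_strat (e : (P.Dec × P.Dec) ⊕ P.UDec ⊕ P.UDec) (v : P.UDec)
    (i : P.Choice v) : workReg e ≠ .strat v i := by simp [workReg]

@[simp] theorem workReg_ne_play (e : (P.Dec × P.Dec) ⊕ P.UDec ⊕ P.UDec) (σ : P.Seq) :
    workReg e ≠ .play σ := by simp [workReg]

@[simp] theorem workReg_ne_utility (e : (P.Dec × P.Dec) ⊕ P.UDec ⊕ P.UDec) (σ : P.Seq) :
    workReg e ≠ .utility σ := by simp [workReg]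

/-- The register of a coordinate of the pair `(A, B)`. -/
noncomputable def coordReg : P.Coord → P.Register
  | .inl (σ, τ) => .matrix σ τ
  | .inr e => workReg (.inl e)

/-- The register of the mass that arrives at a decision point. -/
noncomputable def arrivalReg (v : P.UDec) : P.Register := workReg (.inr (.inl v))

/-- The register of a counterfactual value. -/
noncomputable def valueReg (v : P.UDec) : P.Register := workReg (.inr (.inr v))

/-- The computation of `(A, B)` from the local strategies. -/
noncomputable def forwardArgs : P.Coord ⊕ P.UDec → List (P.Register × P.Register)
  | .inl (.inl (none, τ)) => if τ = none then [(.work 1, .work 1)] else []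
  | .inl (.inl (some ⟨j, a⟩, τ)) => [(.strat (j, τ) (.inl a), arrivalReg (j, τ))]
  | .inl (.inr (j, k)) =>
      [(.strat (j, P.parent k) (.inr ⟨k, rfl⟩), arrivalReg (j, P.parent k))]
  | .inr (j, none) => [(coordReg (.inl (P.parent j, none)), .work 1)]
  | .inr (j, some ⟨k, a⟩) =>
      [(coordReg (.inl (P.parent j, some ⟨k, a⟩)), .work 1), (coordReg (.inr (j, k)), .work 1)]

theorem forwardArgs_choice (v : P.UDec) (i : P.Choice v) :
    forwardArgs (.inl (choiceCoord v i)) = [(.strat v i, arrivalReg v)] := by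
  obtain ⟨j, τ⟩ := v
  rcases i with a | ⟨k, (rfl : P.parent k = τ)⟩ <;> rfl

theorem mem_forwardArgs_arrival {v : P.UDec} {p : P.Register × P.Register}
    (hp : p ∈ forwardArgs (.inr v)) : ∃ e, Feeds e v ∧ p = (coordReg e, .work 1) := by
  obtain ⟨j, _ | ⟨k, a⟩⟩ := v
  · rw [forwardArgs, List.mem_singleton] at hp
    exact ⟨_, .observe j _, hp⟩
  · simp only [forwardArgs, List.mem_cons, List.not_mem_nil, or_false] at hp
    rcases hp with hp | hp
    · exact ⟨_, .observe j _, hp⟩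
    · exact ⟨_, .reply j k a, hp⟩

theorem coordReg_injective : Function.Injective (coordReg (P := P)) := by
  rintro (⟨σ, τ⟩ | e) (⟨σ', τ'⟩ | e') h <;> simp_all [coordReg]
  exact (workReg_ne_matrix _ _ _ h.symm).elim

theorem coordReg_ne_arrivalReg (e : P.Coord) (v : P.UDec) : coordReg e ≠ arrivalReg v := by
  rcases e with ⟨σ, τ⟩ | e
  · exact (workReg_ne_matrix _ σ τ).symm
  · simp [coordReg, arrivalReg]

theorem coordReg_ne_work (e : P.Coord) : coordReg e ≠ .work 0 ∧ coordReg e ≠ .work 1 := by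
  rcases e with ⟨σ, τ⟩ | e <;> simp [coordReg]

theorem coordReg_ne_strat (e : P.Coord) (v : P.UDec) (i : P.Choice v) :
    coordReg e ≠ .strat v i := by
  rcases e with ⟨σ, τ⟩ | e <;> simp [coordReg]

variable (P) in
/-- The forward pass: from the local strategies to `(A, B)`. -/
noncomputable def forwardPass : P.Schedule (P.Coord ⊕ P.UDec) where
  dst := Sum.elim coordReg arrivalReg
  args := forwardArgs
  -- Even ranks for coordinates and odd ones for arrivals: an arrival follows its feeding
  -- coordinates of equal depth and precedes its choices one level further down.
  rank := Sum.elim (fun e => 2 * P.coordDepth e) fun v => 2 * P.decDepth v + 1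
  dst_injective := by
    refine Function.Injective.sumElim coordReg_injective ?_ coordReg_ne_arrivalReg
    intro v v' h
    simpa [arrivalReg] using h
  dst_ne_scratch := by
    rintro (e | v)
    · exact (coordReg_ne_work e).1
    · exact workReg_ne_zero _
  dst_ne_one := by
    rintro (e | v)
    · exact (coordReg_ne_work e).2
    · exact workReg_ne_one _
  args_ne_scratch := by
    rintro (e | v) p hp
    · obtain ⟨τ, rfl⟩ | ⟨v, i, rfl⟩ := eq_root_or_exists_choiceCoord e
      · simp only [forwardArgs] at hp
        split_ifs at hp
        · rw [List.mem_singleton.1 hp]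
          simp
        · simp at hp
      · rw [forwardArgs_choice, List.mem_singleton] at hp
        rw [hp]
        exact ⟨by simp, workReg_ne_zero _⟩
    · obtain ⟨e, -, rfl⟩ := mem_forwardArgs_arrival hp
      exact ⟨(coordReg_ne_work e).1, by simp⟩
  rank_lt := by
    rintro (e | v) p hp i' h
    · obtain ⟨τ, rfl⟩ | ⟨v, i, rfl⟩ := eq_root_or_exists_choiceCoord e
      · simp only [forwardArgs] at hp
        split_ifs at hp
        · rw [List.mem_singleton.1 hp] at h
          rcases i' with e | v
          · simp [(coordReg_ne_work e).2.symm] at h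
          · simp [arrivalReg, (workReg_ne_one _).symm] at h
        · simp at hp
      · rw [forwardArgs_choice, List.mem_singleton] at hp
        rw [hp] at h
        rcases i' with e | u
        · simp [(coordReg_ne_strat e v i).symm, (coordReg_ne_arrivalReg e v).symm] at h
        · simp only [Sum.elim_inr, arrivalReg, (workReg_ne_strat _ v i).symm, workReg_inj,
            Sum.inr.injEq, Sum.inl.injEq, false_or] at h
          subst h
          simp only [Sum.elim_inl, Sum.elim_inr, coordDepth_choiceCoord]
          push_cast
          linarith
    · obtain ⟨e, he, rfl⟩ := mem_forwardArgs_arrival hp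
      rcases i' with e' | u
      · simp only [Sum.elim_inl, coordReg_injective.eq_iff, (coordReg_ne_work e').2.symm,
          or_false] at h
        subst h
        simp only [Sum.elim_inl, Sum.elim_inr, he.coordDepth_eq]
        linarith
      · simp only [Sum.elim_inr, arrivalReg, (workReg_ne_one _).symm,
          or_false] at h
        exact (coordReg_ne_arrivalReg _ _ h).elim

/-- The computation of the counterfactual utilities and values. -/
noncomputable def backwardArgs :
    (Σ v : P.UDec, P.Choice v) ⊕ P.UDec → List (P.Register × P.Register)
  | .inl ⟨(j, τ), .inl a⟩ => (.utility (P.child j a), .play τ) ::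
      (univ : Finset (P.Next (P.child j a))).toList.map fun k => (valueReg (k.1, τ), .work 1)
  | .inl ⟨(j, _), .inr k⟩ =>
      (univ : Finset (P.Act k.1)).toList.map fun a => (valueReg (j, P.child k.1 a), .work 1)
  | .inr v => (univ : Finset (P.Choice v)).toList.map fun i => (.strat v i, .gain v i)

theorem mem_backwardArgs_gain {v : P.UDec} {i : P.Choice v} {p : P.Register × P.Register}
    (hp : p ∈ backwardArgs (.inl ⟨v, i⟩)) : (∃ σ τ, p = (.utility σ, .play τ)) ∨
      ∃ u, P.decDepth u = P.decDepth v + 1 ∧ p = (valueReg u, .work 1) := by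
  obtain ⟨j, τ⟩ := v
  rcases i with a | k
  · simp only [backwardArgs, List.mem_cons, List.mem_map] at hp
    rcases hp with hp | ⟨k, -, hp⟩
    · exact .inl ⟨_, _, hp⟩
    · refine .inr ⟨_, ?_, hp.symm⟩
      simp only [decDepth, depth_of_parent k.2]
      omega
  · simp only [backwardArgs, List.mem_map] at hp
    obtain ⟨a, -, hp⟩ := hp
    refine .inr ⟨_, ?_, hp.symm⟩
    have := P.seqDepth_parent k.1
    rw [k.2] at this
    simp only [decDepth, seqDepth_child] at *
    omega

variable (P) in
/-- The backward pass: counterfactual utilities and values. -/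
noncomputable def backwardPass : P.Schedule ((Σ v : P.UDec, P.Choice v) ⊕ P.UDec) where
  dst := Sum.elim (fun c => .gain c.1 c.2) valueReg
  args := backwardArgs
  -- The depths are negated to proceed from the leaves: values one level below, then the gains at
  -- `v`, then the value of `v`.
  rank := Sum.elim (fun c => -2 * P.decDepth c.1 - 1) fun v => -2 * P.decDepth v
  dst_injective := by
    refine Function.Injective.sumElim ?_ ?_ ?_
    · rintro ⟨v, i⟩ ⟨v', i'⟩ h
      simpa using h
    · intro v v' h
      simpa [valueReg] using h
    · exact fun c v => (workReg_ne_gain _ _ _).symm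
  dst_ne_scratch := by
    rintro (c | v)
    · simp
    · exact workReg_ne_zero _
  dst_ne_one := by
    rintro (c | v)
    · simp
    · exact workReg_ne_one _
  args_ne_scratch := by
    rintro (⟨v, i⟩ | v) p hp
    · obtain ⟨σ, τ, rfl⟩ | ⟨u, -, rfl⟩ := mem_backwardArgs_gain hp
      · simp
      · exact ⟨workReg_ne_zero _, by simp⟩
    · obtain ⟨i, -, rfl⟩ := List.mem_map.1 hp
      simp
  rank_lt := by
    rintro (⟨v, i⟩ | v) p hp i' h
    · obtain ⟨σ, τ, rfl⟩ | ⟨u, hu, rfl⟩ := mem_backwardArgs_gain hp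
      · rcases i' with c | u
        · simp at h
        · simp [valueReg, (workReg_ne_utility _ σ).symm, (workReg_ne_play _ τ).symm] at h
      · rcases i' with c | u'
        · simp [valueReg] at h
        · simp only [Sum.elim_inr, valueReg, (workReg_ne_one _).symm, workReg_inj,
            Sum.inr.injEq, or_false] at h
          subst h
          simp only [Sum.elim_inl, Sum.elim_inr, hu]
          push_cast
          linarith
    · obtain ⟨i, -, rfl⟩ := List.mem_map.1 hp
      rcases i' with ⟨v', i'⟩ | u
      · simp only [Sum.elim_inl, reduceCtorEq, Register.gain.injEq, false_or] at h
        obtain ⟨rfl, -⟩ := h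
        simp only [Sum.elim_inl, Sum.elim_inr]
        linarith
      · simp [valueReg, (workReg_ne_strat _ v i).symm, (workReg_ne_gain _ v i).symm] at h

end Machine

end TreeFormDecisionProblem

namespace TreeFormDecisionProblem

/-! ### Operation counts and the implementation of an iteration. -/

section Implementation

variable {P : TreeFormDecisionProblem.{u}}

/-- Entries of `A` and of `B` cost at most 3 steps each and arrivals at most 5; there are at most `d
^ 2` of each kind. -/
theorem sum_forwardArgs_le :
    ∑ i, (1 + 2 * (P.forwardPass.args i).length) ≤ 11 * P.size ^ 2 := by
  have hJ := card_dec_lt_size (P := P)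
  have h1 : ∀ e : P.Coord, 1 + 2 * (forwardArgs (.inl e)).length ≤ 3 := by
    intro e
    obtain ⟨τ, rfl⟩ | ⟨v, i, rfl⟩ := eq_root_or_exists_choiceCoord e
    · simp only [forwardArgs]
      split_ifs <;> simp
    · simp [forwardArgs_choice]
  have h2 : ∀ v : P.UDec, 1 + 2 * (forwardArgs (.inr v)).length ≤ 5 := by
    rintro ⟨j, _ | ⟨k, a⟩⟩ <;> simp [forwardArgs]
  rw [Fintype.sum_sum_type]
  refine (add_le_add (sum_le_sum fun e _ => h1 e) (sum_le_sum fun v _ => h2 v)).trans ?_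
  simp only [sum_const, card_univ, smul_eq_mul, Fintype.card_sum, Fintype.card_prod]
  change (P.size * P.size + _) * 3 + Fintype.card P.Dec * P.size * 5 ≤ _
  nlinarith

/-- The bounds 5, 5 and 3 are for values, for gains of actions and for gains of queries. Long sums
are harmless because each decision point follows one sequence and each action belongs to one
decision point. -/
theorem sum_backwardArgs_le :
    ∑ i, (1 + 2 * (P.backwardPass.args i).length) ≤ 13 * P.size ^ 2 := by
  have hJ := card_dec_lt_size (P := P)
  have hA := sum_card_act (P := P)
  have hV : ∑ v : P.UDec, (1 + 2 * (backwardArgs (.inr v)).length) ≤ 5 * P.size ^ 2 := by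
    have := sum_card_choice_le (P := P)
    simp only [backwardArgs, List.length_map, length_toList, card_univ, sum_add_distrib,
      ← mul_sum, sum_const, Fintype.card_prod, smul_eq_mul, mul_one]
    change Fintype.card P.Dec * P.size + _ ≤ _
    nlinarith
  have hplay : ∑ j, ∑ τ, ∑ a, (1 + 2 * (backwardArgs (P := P) (.inl ⟨(j, τ), .inl a⟩)).length) ≤
      5 * P.size ^ 2 := by
    have h1 : ∑ j, ∑ a, Fintype.card (P.Next (P.child j a)) ≤ Fintype.card P.Dec := by
      rw [← sum_card_next (P := P), sum_seq]
      exact Nat.le_add_left _ _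
    have h2 : ∀ j (τ : P.Seq),
        ∑ a, (1 + 2 * (backwardArgs (P := P) (.inl ⟨(j, τ), .inl a⟩)).length) =
          3 * Fintype.card (P.Act j) + 2 * ∑ a, Fintype.card (P.Next (P.child j a)) := by
      intro j τ
      simp only [backwardArgs, List.length_cons, List.length_map, length_toList, card_univ,
        mul_add, sum_add_distrib, sum_const, smul_eq_mul, mul_one, ← mul_sum]
      ring
    rw [sum_comm]
    simp only [h2, sum_const, card_univ, smul_eq_mul, sum_add_distrib, ← mul_sum]
    change P.size * _ ≤ _
    nlinarith
  have hquery : ∑ j, ∑ τ, ∑ k : P.Next τ,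
      (1 + 2 * (backwardArgs (P := P) (.inl ⟨(j, τ), .inr k⟩)).length) ≤ 3 * P.size ^ 2 := by
    have h1 : ∀ j, ∑ τ, ∑ k : P.Next τ,
        (1 + 2 * (backwardArgs (P := P) (.inl ⟨(j, τ), .inr k⟩)).length) =
          Fintype.card P.Dec + 2 * ∑ k, Fintype.card (P.Act k) := by
      intro j
      simp only [backwardArgs, List.length_map, length_toList, card_univ]
      rw [sum_next fun _ k => 1 + 2 * Fintype.card (P.Act k)]
      simp [sum_add_distrib, mul_sum]
    simp only [h1, sum_const, card_univ, smul_eq_mul]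
    nlinarith
  have hsplit : ∑ i, (1 + 2 * (P.backwardPass.args i).length) =
      (∑ j, ∑ τ, ∑ a, (1 + 2 * (backwardArgs (P := P) (.inl ⟨(j, τ), .inl a⟩)).length) +
      ∑ j, ∑ τ, ∑ k : P.Next τ,
        (1 + 2 * (backwardArgs (P := P) (.inl ⟨(j, τ), .inr k⟩)).length)) +
      ∑ v : P.UDec, (1 + 2 * (backwardArgs (.inr v)).length) := by
    rw [Fintype.sum_sum_type, Fintype.sum_sigma, Fintype.sum_prod_type]
    congr 1
    rw [← sum_add_distrib]
    refine Fintype.sum_congr _ _ fun j => ?_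
    rw [← sum_add_distrib]
    exact Fintype.sum_congr _ _ fun τ => Fintype.sum_sum_type _
  rw [hsplit]
  linarith

theorem one_le_size : 1 ≤ P.size := Fintype.card_pos

/-- The implementation of counterfactual regret minimization by straight-line programs. -/
theorem exists_implementation (P : TreeFormDecisionProblem.{u}) : ∃ p q : List P.Instr,
    (∀ (R : ∀ v : P.UDec, LocalMinimizer (P.Choice v))
      (fixpt : Matrix P.Seq P.Seq ℝ → P.Seq → ℝ), IsFixedPointOracle fixpt →
      ∀ w : ℕ → P.Seq → ℝ, ∃ run : P.CFRRun R w, ∀ t,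
        run.x t = fixpt (devMatrix (run.dev t)) ∧
        ∀ σ, (playState R fixpt p q w t).mem (.play σ) = run.x t σ) ∧
    ∀ (f : ℕ) (ca ct : P.UDec → ℕ), progCost f ca ct p + progCost f ca ct q
      ≤ f + (∑ v, (ca v + ct v)) + 32 * P.size ^ 2 := by
  obtain ⟨a, ha, hac⟩ := P.forwardPass.exists_program
  obtain ⟨b, hb, hbc⟩ := P.backwardPass.exists_program
  set p : List P.Instr := (univ : Finset P.UDec).toList.map .ask ++ (a ++ [.fix]) with hp
  set q : List P.Instr := b ++ (univ : Finset P.UDec).toList.map .tell with hq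
  refine ⟨p, q, fun R fixpt hfix w => ?_, fun f ca ct => ?_⟩
  · let st := stateAt R fixpt p q w
    let s₁ : ℕ → P.MachineState := fun t =>
      runProg R fixpt ((univ : Finset P.UDec).toList.map .ask) (st t)
    let s₂ : ℕ → P.MachineState := fun t => runProg R fixpt a (s₁ t)
    let s₃ : ℕ → P.MachineState := fun t => Instr.exec R fixpt (s₂ t) .fix
    let s₄ : ℕ → P.MachineState := fun t => runProg R fixpt b ((s₃ t).observe (w t))
    have hplay : ∀ t, playState R fixpt p q w t = s₃ t := fun t => by
      rw [playState, hp, runProg_append, runProg_append]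
      rfl
    have hst : ∀ t, st (t + 1) =
        runProg R fixpt ((univ : Finset P.UDec).toList.map .tell) (s₄ t) := fun t => by
      have : st (t + 1) = runProg R fixpt q ((playState R fixpt p q w t).observe (w t)) := rfl
      rw [this, hplay, hq, runProg_append]
    have hask := fun t => runProg_ask (R := R) (fixpt := fixpt)
      (univ : Finset P.UDec).toList (st t)
    have htell := fun t => runProg_tell (R := R) (fixpt := fixpt)
      (nodup_toList (univ : Finset P.UDec)) (s₄ t)
    -- the forward pass
    have hstrat : ∀ t v i, (s₂ t).mem (.strat v i) = (R v).next ((st t).hist v) i := by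
      intro t v i
      refine ((ha R fixpt (s₁ t)).2.2.2 _ ?_ (by simp) (by simp)).trans
        ((hask t).2 v (by simp) i)
      rintro (e | u)
      · exact (coordReg_ne_strat e v i).symm
      · exact (workReg_ne_strat _ v i).symm
    have hfwd : ∀ t i, (s₂ t).mem (P.forwardPass.dst i) = ((P.forwardPass.args i).map fun p' =>
        (s₂ t).mem p'.1 * (s₂ t).mem p'.2).sum := fun t => (ha R fixpt (s₁ t)).2.2.1
    have hone : ∀ t, (s₂ t).mem (.work 1) = 1 := fun t => (ha R fixpt (s₁ t)).2.1
    let dev : ℕ → P.Coord → ℝ := fun t e => (s₂ t).mem (coordReg e)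
    have harr : ∀ t v, (s₂ t).mem (arrivalReg v) = arrival v (dev t) := by
      intro t v
      refine (hfwd t (.inr v)).trans ?_
      obtain ⟨j, _ | ⟨k, c⟩⟩ := v <;>
        simp [forwardPass, forwardArgs, hone, arrival, queryMass, dev]
    have hgen : ∀ t, Generates (fun v i => (s₂ t).mem (.strat v i)) (dev t) := by
      refine fun t => ⟨?_, fun τ hτ => ?_, fun v i => ?_⟩
      · refine (hfwd t (.inl (.inl (none, none)))).trans ?_
        simp [forwardPass, forwardArgs, hone]
      · refine (hfwd t (.inl (.inl (none, τ)))).trans ?_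
        simp only [forwardPass, forwardArgs, if_neg hτ]
        rfl
      · refine (hfwd t (.inl (choiceCoord v i))).trans ?_
        simp only [forwardPass, forwardArgs_choice, List.map_singleton, List.sum_singleton, harr]
    have hmem : ∀ t v, (fun i => (s₂ t).mem (.strat v i)) ∈ stdSimplex ℝ (P.Choice v) := by
      intro t v
      simp only [hstrat]
      exact (R v).next_mem _
    -- The oracle promises a fixed point only for matrices that preserve `co X`, so the registers
    -- must first be recognized as a pair generated by local strategies.
    have hfixed := fun t => hfix _ ((hgen t).mapsTo_coX (hmem t))
    -- the backward pass
    have hbwd : ∀ t i, (s₄ t).mem (P.backwardPass.dst i) = ((P.backwardPass.args i).map fun p' =>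
        (s₄ t).mem p'.1 * (s₄ t).mem p'.2).sum := fun t =>
      (hb R fixpt ((s₃ t).observe (w t))).2.2.1
    have hone' : ∀ t, (s₄ t).mem (.work 1) = 1 := fun t =>
      (hb R fixpt ((s₃ t).observe (w t))).2.1
    have hutil : ∀ t σ, (s₄ t).mem (.utility σ) = w t σ := by
      intro t σ
      refine ((hb R fixpt ((s₃ t).observe (w t))).2.2.2 _ ?_ (by simp) (by simp)).trans rfl
      rintro (c | u)
      · simp [backwardPass]
      · exact (workReg_ne_utility _ σ).symm
    have hplay' : ∀ t σ, (s₄ t).mem (.play σ) = fixpt (devMatrix (dev t)) σ := by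
      intro t σ
      refine ((hb R fixpt ((s₃ t).observe (w t))).2.2.2 _ ?_ (by simp) (by simp)).trans rfl
      rintro (c | u)
      · simp [backwardPass]
      · exact (workReg_ne_play _ σ).symm
    have hstrat' : ∀ t v i, (s₄ t).mem (.strat v i) = (s₂ t).mem (.strat v i) := by
      intro t v i
      refine ((hb R fixpt ((s₃ t).observe (w t))).2.2.2 _ ?_ (by simp) (by simp)).trans rfl
      rintro (c | u)
      · simp [backwardPass]
      · exact (workReg_ne_strat _ v i).symm
    -- Only `tell` extends the histories, so what the minimizers have seen is exactly the list of
    -- computed gains; this closes the loop between iterations.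
    have hhist : ∀ t v, (st t).hist v = history (fun s i => (s₄ s).mem (.gain v i)) t := by
      intro t v
      induction t with
      | zero => rfl
      | succ t ih =>
        rw [hst, (htell t).2 v, if_pos (by simp), history_succ, ← ih]
        congr 1
        have h4 : (s₄ t).hist = (s₃ t).hist := (hb R fixpt ((s₃ t).observe (w t))).1
        have h2 : (s₂ t).hist = (s₁ t).hist := (ha R fixpt (s₁ t)).1
        have h3 : (s₃ t).hist = (s₂ t).hist := rfl
        rw [h4, h3, h2]
        exact congrFun (hask t).1 v
    refine ⟨{
      strat := fun t v i => (s₂ t).mem (.strat v i)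
      dev := dev
      x := fun t => fixpt (devMatrix (dev t))
      gain := fun t v i => (s₄ t).mem (.gain v i)
      value := fun t v => (s₄ t).mem (valueReg v)
      strat_eq := fun t v => funext fun i => (hstrat t v i).trans (by rw [hhist])
      dev_root := fun t => (hgen t).root
      dev_root_of_ne := fun t => (hgen t).root_of_ne
      dev_choice := fun t => (hgen t).choice
      x_mem := fun t => (hfixed t).1
      x_fixed := fun t => (hfixed t).2
      gain_play := fun t j τ c => ?_
      gain_query := fun t j τ k => ?_
      value_eq := fun t v => ?_ }, fun t => ⟨rfl, fun σ => ?_⟩⟩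
    · refine (hbwd t (.inl ⟨(j, τ), .inl c⟩)).trans ?_
      simp only [backwardPass, backwardArgs, List.map_cons, List.map_map, List.sum_cons, hutil,
        hplay']
      congr 1
      rw [← sum_map_toList]
      congr 1
      refine List.map_congr_left fun k _ => ?_
      simp [hone']
    · refine (hbwd t (.inl ⟨(j, τ), .inr k⟩)).trans ?_
      simp only [backwardPass, backwardArgs, List.map_map]
      rw [← sum_map_toList]
      congr 1
      refine List.map_congr_left fun k _ => ?_
      simp [hone']
    · refine (hbwd t (.inr v)).trans ?_
      simp only [backwardPass, backwardArgs, List.map_map]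
      rw [← sum_map_toList]
      congr 1
      refine List.map_congr_left fun k _ => ?_
      simp [hstrat']
    · rw [hplay]
      rfl
  · have h1 := sum_forwardArgs_le (P := P)
    have h2 := sum_backwardArgs_le (P := P)
    have h3 := sum_card_choice_le (P := P)
    have h4 := one_le_size (P := P)
    have h5 : progCost f ca ct [(.fix : P.Instr)] = P.size ^ 2 + P.size + f := by
      simp [progCost, Instr.cost]
    rw [hp, hq, progCost_append, progCost_append, progCost_append, progCost_ask, progCost_tell,
      hac, hbc, h5]
    have h6 : ∑ v, (ca v + ct v) = ∑ v, ca v + ∑ v, ct v := sum_add_distrib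
    have h7 : P.size ≤ P.size ^ 2 := Nat.le_self_pow two_ne_zero _
    rw [h6]
    linarith

/-- The cost of an iteration relative to that of the fixed-point computation. -/
theorem cost_le_of_le {p q : List P.Instr} {f K C : ℕ} {ca ct : P.UDec → ℕ}
    (h : progCost f ca ct p + progCost f ca ct q ≤ f + (∑ v, (ca v + ct v)) + K * P.size ^ 2)
    (hK : 1 ≤ K) (hC : ∀ v, ca v + ct v ≤ C * Fintype.card (P.Choice v)) :
    progCost f ca ct p + progCost f ca ct q ≤ (K + 2 * C) * Instr.cost f ca ct (.fix : P.Instr) := by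
  have h1 : ∑ v, (ca v + ct v) ≤ C * (2 * P.size ^ 2) := by
    refine (sum_le_sum fun v _ => hC v).trans ?_
    rw [← mul_sum]
    exact Nat.mul_le_mul_left C sum_card_choice_le
  calc _ ≤ f + C * (2 * P.size ^ 2) + K * P.size ^ 2 := by omega
    _ ≤ K * f + 2 * C * P.size ^ 2 + K * P.size ^ 2 := by nlinarith
    _ ≤ (K + 2 * C) * (P.size ^ 2 + P.size + f) := by
      have h2 : 0 ≤ (K + 2 * C) * P.size := Nat.zero_le _
      have h3 : 0 ≤ 2 * C * f := Nat.zero_le _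
      linarith

end Implementation

end TreeFormDecisionProblem

theorem theorem2 :
    -- local regret minimizers with the rate used below exist
    (∀ (ι : Type u) [Fintype ι] [Nonempty ι],
      ∃ R : LocalMinimizer ι, R.HasRegret fun T => (Fintype.card ι : ℝ) * Real.sqrt T) ∧
    ∃ K : ℕ, ∀ P : TreeFormDecisionProblem.{u},
      -- the UTC polytope is a chain of scaled extensions, one simplex per UTC decision point
      (∃ order : List P.UDec, order.Nodup ∧ (∀ v, v ∈ order) ∧
        ScaledExtensionChain P.rootPoint P.rootCoords
          (order.map fun v =>
            (Finset.univ.image (TreeFormDecisionProblem.choiceCoord v),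
              TreeFormDecisionProblem.arrival v))
          Finset.univ P.utcPolytope) ∧
      -- correctness and regret of CFR with arbitrary local minimizers
      (∀ (R : ∀ v : P.UDec, LocalMinimizer (P.Choice v)) (w : ℕ → P.Seq → ℝ),
        (∀ t, P.IsUtility (w t)) → ∀ run : P.CFRRun R w,
        (∀ t, run.dev t ∈ P.utcPolytope ∧
          Set.MapsTo (TreeFormDecisionProblem.devMatrix (run.dev t)).mulVec P.coX P.coX ∧
          (fun x : P.X => (TreeFormDecisionProblem.devMatrix (run.dev t)).mulVec x) ∈
            P.utcDeviations) ∧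
        ∀ ρ : P.UDec → ℕ → ℝ, (∀ v, (R v).HasRegret (ρ v)) →
        ∀ π : ℕ → P.X → ℝ, (∀ t, π t ∈ stdSimplex ℝ P.X) →
          (∀ t, TreeFormDecisionProblem.mean (π t) = run.x t) →
        ∀ T : ℕ,
          (TreeFormDecisionProblem.PhiRegretLE P.utcDeviations π w T (∑ v, ρ v T) ∧
            TreeFormDecisionProblem.PhiRegretLE P.linearDeviations π w T (∑ v, ρ v T)) ∧
          ∀ C : ℝ, 0 ≤ C → (∀ v, ρ v T ≤ C * Fintype.card (P.Choice v) * Real.sqrt T) →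
            TreeFormDecisionProblem.PhiRegretLE P.utcDeviations π w T
              (2 * C * (P.size : ℝ) ^ 2 * Real.sqrt T) ∧
            TreeFormDecisionProblem.PhiRegretLE P.linearDeviations π w T
              (2 * C * (P.size : ℝ) ^ 2 * Real.sqrt T)) ∧
      -- every linear map from `co X` to `co X` has a fixed point, so that oracles exist
      (∃ fixpt : Matrix P.Seq P.Seq ℝ → P.Seq → ℝ,
        TreeFormDecisionProblem.IsFixedPointOracle fixpt) ∧
      -- implementation: one fixed-point computation per iteration, and `O(d ^ 2)` other steps
      ∃ p q : List P.Instr,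
        (∀ (R : ∀ v : P.UDec, LocalMinimizer (P.Choice v))
          (fixpt : Matrix P.Seq P.Seq ℝ → P.Seq → ℝ),
          TreeFormDecisionProblem.IsFixedPointOracle fixpt → ∀ w : ℕ → P.Seq → ℝ,
          ∃ run : P.CFRRun R w, ∀ t,
            run.x t = fixpt (TreeFormDecisionProblem.devMatrix (run.dev t)) ∧
            ∀ σ, (TreeFormDecisionProblem.playState R fixpt p q w t).mem (.play σ) = run.x t σ) ∧
        ∀ (f : ℕ) (ca ct : P.UDec → ℕ),
          TreeFormDecisionProblem.progCost f ca ct p + TreeFormDecisionProblem.progCost f ca ct q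
            ≤ f + (∑ v, (ca v + ct v)) + K * P.size ^ 2 ∧
          ∀ C : ℕ, (∀ v, ca v + ct v ≤ C * Fintype.card (P.Choice v)) →
            TreeFormDecisionProblem.progCost f ca ct p + TreeFormDecisionProblem.progCost f ca ct q
              ≤ (K + 2 * C) * TreeFormDecisionProblem.Instr.cost f ca ct (.fix : P.Instr) := by
  -- In units of `d ^ 2`: 11 and 13 for the two passes, 4 for exchanges with the minimizers, 2 for
  -- `d ^ 2 + d` numbers exchanged with the oracle, and 2 for setting the constant one twice.
  refine ⟨fun ι _ _ => exists_localMinimizer ι, 32, fun P => ⟨P.exists_scaledExtensionChain,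
    fun _ _ hw run => run.correctness hw, P.exists_isFixedPointOracle, ?_⟩⟩
  obtain ⟨p, q, hrun, hcost⟩ := P.exists_implementation
  exact ⟨p, q, hrun, fun f ca ct => ⟨hcost f ca ct, fun _ hC =>
    TreeFormDecisionProblem.cost_le_of_le (hcost f ca ct) (by norm_num) hC⟩⟩
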